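/- Let $n\ge 1$, let $T=T^{n-1}=(S^1)^{n-1}$ be the compact torus, and let $T$ act smoothly on a closed (compact, Hausdorff, without boundary, not necessarily connected) smooth manifold $X$ of dimension $2n$. For a closed subgroup $H\subseteq T$ put $X^H=\{x\in X\mid T_x=H\}$, where $T_x$ is the stabilizer of $x$. Assume: (1) The action is appropriate, that is: it is effective; the set $X^T$ of fixed points is finite; and (adjoining condition) for every closed subgroup $H\neq T$, the closure of every connected component of $X^H$ contains a point $x'$ with $\dim T_{x'}>\dim H$. (2) The action is in general position, that is: at every fixed point $x\in X^T$, with tangent representation $T_xX\cong V(\alpha_1)\oplus\dots\oplus V(\alpha_n)$, every $n-1$ of the $n$ weights $\alpha_1,\dots,\alpha_n\in\operatorname{Hom}(T,S^1)\cong\mathbb Z^{n-1}$ are linearly independent over $\mathbb{Z}$. Here $V(\alpha)$ denotes $\mathbb C$, regarded as a real representation, on which $t\in T$ acts as multiplication by $\alpha(t)$; the weights are determined up to order and signs, which do not affect the condition. Then the orbit space $X/T$, with the quotient topology, is a topological manifold of dimension $n+1$ (Hausdorff, second countable, and locally homeomorphic to $\mathbb R^{n+1}$). The stabilizers $T_x$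 are not assumed to be connected. -/

import Mathlib

open scoped Manifold ContDiff

/-- The compact torus `(S¹)^k`, with its product group structure, topology and charts. -/
abbrev Torus (k : ℕ) : Type := Fin k → Circle

/-- The model with corners of the torus `(S¹)^k`: the `k`-fold product of the model of `S¹`. -/
noncomputable abbrev torusModel (k : ℕ) :
    ModelWithCorners ℝ (Fin k → EuclideanSpace ℝ (Fin 1))
      (ModelPi fun _ : Fin k => EuclideanSpace ℝ (Fin 1)) :=
  ModelWithCorners.pi fun _ : Fin k => 𝓡 1

/-- The exponential map `ℝ^k → (S¹)^k`. -/
noncomputable def torusExp {k : ℕ} (v : Fin k → ℝ) : Torus k := fun i => Circle.exp (v i)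

/-- The Lie algebra of a (closed) subgroup `H` of the torus: all `v` whose one-parameter subgroup
`s ↦ exp (s v)` lies in `H`. -/
noncomputable def torusLieAlgebra {k : ℕ} (H : Subgroup (Torus k)) :
    Submodule ℝ (Fin k → ℝ) where
  carrier := {v | ∀ s : ℝ, torusExp (s • v) ∈ H}
  zero_mem' := by
    intro s
    have h : torusExp (s • (0 : Fin k → ℝ)) = 1 := by
      funext i
      simp [torusExp]
    rw [h]
    exact H.one_mem
  add_mem' := by
    intro v w hv hw s
    have h : torusExp (s • (v + w)) = torusExp (s • v) * torusExp (s • w) := by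
      funext i
      simp [torusExp, mul_add, Circle.exp_add]
    rw [h]
    exact H.mul_mem (hv s) (hw s)
  smul_mem' := by
    intro c v hv s
    rw [smul_smul]
    exact hv (s * c)

/-- The dimension, as a Lie group, of a (closed) subgroup of the torus. -/
noncomputable def subgroupDim {k : ℕ} (H : Subgroup (Torus k)) : ℕ :=
  Module.finrank ℝ (torusLieAlgebra H)

/-- The piece `X^H` of the fine partition by orbit types: the points with stabilizer exactly `H`. -/
def orbitTypePiece {k : ℕ} (X : Type*) [MulAction (Torus k) X] (H : Subgroup (Torus k)) : Set X :=
  {x | MulAction.stabilizer (Torus k) x = H}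

/-- An appropriate torus action: it is effective, has finitely many fixed points, and the closure
of every connected component of every `X^H`, `H ≠ T` closed, contains a point whose stabilizer has
dimension greater than `dim H`. -/
structure IsAppropriate (k : ℕ) (X : Type*) [TopologicalSpace X] [MulAction (Torus k) X] :
    Prop where
  effective : FaithfulSMul (Torus k) X
  finite_fixedPoints : (MulAction.fixedPoints (Torus k) X).Finite
  adjoining : ∀ H : Subgroup (Torus k), IsClosed (H : Set (Torus k)) → H ≠ ⊤ →
    ∀ x ∈ orbitTypePiece X H,
      ∃ x' ∈ closure (connectedComponentIn (orbitTypePiece X H) x),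
        subgroupDim H < subgroupDim (MulAction.stabilizer (Torus k) x')

/-- `α₁, …, αₙ ∈ Hom(T, S¹)` are weights of the real representation `ρ` of the torus on `V`:
`V ≅ V(α₁) ⊕ ⋯ ⊕ V(αₙ)` equivariantly, where `t` acts on `V(α) = ℂ` by multiplication by `α t`. -/
def HasWeights {k n : ℕ} {V : Type*} [AddCommGroup V] [Module ℝ V]
    (ρ : Torus k → V → V) (α : Fin n → (Torus k →ₜ* Circle)) : Prop :=
  ∃ L : V ≃ₗ[ℝ] (Fin n → ℂ), ∀ (t : Torus k) (v : V) (i : Fin n), L (ρ t v) i = (α i t : ℂ) * L v i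

/-- A list of `n` weights is in general position if every `n - 1` of them are linearly independent
over `ℤ` in the character lattice `Hom(T, S¹)` (written additively). -/
def WeightsInGeneralPosition {k n : ℕ} (α : Fin n → (Torus k →ₜ* Circle)) : Prop :=
  ∀ j : Fin n, LinearIndependent ℤ (fun i : {i : Fin n // i ≠ j} => Additive.ofMul (α i))

/-- The tangent representation at `x`: `t` acts by the derivative at `x` of `y ↦ t • y`.
Only used when `x` is a fixed point. The derivative then maps `T_x X` to `T_{t • x} X = T_x X`;
as every tangent space is by definition the model vector space (read in the preferred chart at the
base point, here the same for `x` and `t • x`), no identification has to be inserted. -/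
noncomputable def tangentRep {k d : ℕ} {X : Type*} [TopologicalSpace X]
    [ChartedSpace (EuclideanSpace ℝ (Fin d)) X] [MulAction (Torus k) X] (x : X) (t : Torus k) :
    TangentSpace (𝓡 d) x → TangentSpace (𝓡 d) x :=
  fun v => mfderiv (𝓡 d) (𝓡 d) (fun y : X => t • y) x v

/-- The action of `T^k` on the `2n`-manifold `X` is in general position: at every fixed point, the
`n` weights of the tangent representation are in general position. -/
def ActionInGeneralPosition (k n : ℕ) (X : Type*) [TopologicalSpace X]
    [ChartedSpace (EuclideanSpace ℝ (Fin (2 * n))) X] [MulAction (Torus k) X] : Prop :=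
  ∀ x ∈ MulAction.fixedPoints (Torus k) X,
    ∃ α : Fin n → (Torus k →ₜ* Circle),
      HasWeights (V := TangentSpace (𝓡 (2 * n)) x) (fun t v => tangentRep x t v) α ∧
        WeightsInGeneralPosition α

/-- `Q` is a topological `d`-manifold (without boundary): Hausdorff, second countable and locally
homeomorphic to open subsets of `ℝ^d`. -/
structure IsTopologicalManifold (d : ℕ) (Q : Type*) [TopologicalSpace Q] : Prop where
  t2 : T2Space Q
  secondCountable : SecondCountableTopology Q
  locallyEuclidean : Nonempty (ChartedSpace (EuclideanSpace ℝ (Fin d)) Q)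

/-! The orbit space is shown to be locally `ℂⁿ / T`, where `T` acts through `n` weights in general
position, and this linear quotient is shown to be `ℝⁿ⁺¹`.

Linear quotient. `n` weights in `ℤⁿ⁻¹` satisfy one primitive relation `∑ cᵢ αᵢ = 0`, and general
position says that every `cᵢ` is nonzero. Primitivity makes the image of `T` in `(S¹)ⁿ` the whole
group `∏ uᵢ ^ cᵢ = 1` (`exists_relation_of_generalPosition`). Its orbits are the fibres of
`modelMap`, which records the differences of the moduli together with the smallest modulus times the
phase `∏ (zᵢ/|zᵢ|) ^ cᵢ`. When some coordinate is zero, its free phase can absorb any value of the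
product because its exponent is nonzero; so the phase is lost exactly where the smallest modulus
vanishes, as in polar coordinates on `ℂ`.

Local models. Call `x` standard for characters `α` of the whole torus if its stabilizer is the
common kernel of some of the `αᵢ` and acts near `x` like the linear action with weights `α`. Fixed
points are standard by averaging a chart (`isLocalDiffeomorphAt_extChartAt_linearization`). At a
standard point the model of the stabilizer extends to a `T`-equivariant local diffeomorphism to `ℂⁿ`
around a vector with entries 0 and 1 (`HasLinearModel.exists_equivariant`). Hence standardness is an
open condition, and `X / T` has a chart there. Disconnected stabilizers need no separate treatment,
since the model never splits the torus as stabilizer times complement.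

Propagation. Among points with a fixed stabilizer standardness is also closed
(`eventually_hasLinearModel_of_stabilizer_eq`), so it passes from a point in the closure of a
component of `X^H` to that whole component. The adjoining condition and induction on the codimension
of the stabilizer then carry the weights of a fixed point to every point. -/

/-! ### Characters of the torus -/

section Characters

/-- A continuous one-parameter subgroup of the circle is `t ↦ exp (i a t)`. -/
theorem Circle.exists_eq_exp_of_continuous_of_map_add {χ : ℝ → Circle} (hc : Continuous χ)
    (hadd : ∀ s t, χ (s + t) = χ s * χ t) : ∃ a : ℝ, ∀ t, χ t = Circle.exp (a * t) := by
  set f : ℝ → ℂ := fun t => (χ t : ℂ) with hf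
  have hfc : Continuous f := continuous_subtype_val.comp hc
  have hfadd : ∀ s t, f (s + t) = f s * f t := fun s t => by simp [hf, hadd]
  have hf0 : f 0 = 1 := by
    have h := hadd 0 0
    simp only [add_zero] at h
    have : χ 0 = 1 := by simpa using h
    simp [hf, this]
  set F : ℝ → ℂ := fun t => ∫ s in (0 : ℝ)..t, f s with hF
  have hFd : ∀ t, HasDerivAt F (f t) t := fun t =>
    intervalIntegral.integral_hasDerivAt_right (hfc.intervalIntegrable _ _)
      hfc.aestronglyMeasurable.stronglyMeasurableAtFilter hfc.continuousAt
  obtain ⟨ε, hε⟩ : ∃ ε, F ε ≠ 0 := by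
    have h := (hFd 0).eventually_ne (c := 0) (by rw [hf0]; exact one_ne_zero)
    exact h.exists
  -- Integrating the functional equation over `[0, ε]` expresses the merely continuous `f` through
  -- its primitive, so `f` is differentiable.
  have hrep : ∀ t, f t = (F (t + ε) - F t) / F ε := by
    intro t
    rw [eq_div_iff hε]
    have h1 : f t * F ε = ∫ s in (0 : ℝ)..ε, f (t + s) := by
      simp only [hfadd, hF]
      rw [intervalIntegral.integral_const_mul]
    rw [h1, intervalIntegral.integral_comp_add_left (fun s => f s), add_zero]
    exact (intervalIntegral.integral_interval_sub_left (hfc.intervalIntegrable _ _)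
      (hfc.intervalIntegrable _ _)).symm
  have hdiff : Differentiable ℝ f := by
    have : f = fun t => (F (t + ε) - F t) / F ε := funext hrep
    rw [this]
    intro t
    exact ((((hFd (t + ε)).comp_add_const t ε).sub (hFd t)).div_const _).differentiableAt
  set c := deriv f 0 with hcdef
  have hder : ∀ t, HasDerivAt f (f t * c) t := by
    intro t
    have h1 : HasDerivAt (fun s => f (s - t)) c t := by
      have h0 : HasDerivAt f c (t - t) := by rw [sub_self]; exact (hdiff 0).hasDerivAt
      exact h0.comp_sub_const t t
    have h2 := h1.const_mul (f t)
    refine h2.congr_of_eventuallyEq (Filter.Eventually.of_forall fun s => ?_)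
    simp only
    rw [← hfadd]; congr 1; ring
  have hexp : ∀ t : ℝ, HasDerivAt (fun s : ℝ => Complex.exp (-c * s)) (Complex.exp (-c * t) * -c) t := by
    intro t
    have h1 : HasDerivAt (fun s : ℝ => -c * (s : ℂ)) (-c) t := by
      simpa using (Complex.ofRealCLM.hasDerivAt (x := t)).const_mul (-c)
    exact h1.cexp
  have hconst : ∀ t : ℝ, f t * Complex.exp (-c * t) = 1 := by
    intro t
    have hd : ∀ s : ℝ, HasDerivAt (fun s : ℝ => f s * Complex.exp (-c * s)) 0 s := by
      intro s
      have := (hder s).mul (hexp s)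
      refine this.congr_deriv ?_
      ring
    have h := is_const_of_deriv_eq_zero (fun s => (hd s).differentiableAt) (fun s => (hd s).deriv) t 0
    simpa [hf0] using h
  have hft : ∀ t : ℝ, f t = Complex.exp (c * t) := by
    intro t
    have h := hconst t
    rw [neg_mul, Complex.exp_neg] at h
    field_simp at h
    exact h
  -- Values of modulus 1 force a purely imaginary exponent.
  have hre : c.re = 0 := by
    have h1 : ‖f 1‖ = 1 := Circle.norm_coe _
    rw [hft, Complex.norm_exp] at h1
    simpa using h1
  refine ⟨c.im, fun t => ?_⟩
  apply Circle.ext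
  rw [Circle.coe_exp]
  have h := hft t
  simp only [hf] at h
  rw [h]
  congr 1
  apply Complex.ext <;> simp [hre]

variable {k : ℕ}

theorem torusExp_add (v w : Fin k → ℝ) : torusExp (v + w) = torusExp v * torusExp w := by
  funext i; simp [torusExp, Circle.exp_add]

@[simp] theorem torusExp_zero : torusExp (0 : Fin k → ℝ) = 1 := by
  funext i; simp [torusExp]

theorem torusExp_neg (v : Fin k → ℝ) : torusExp (-v) = (torusExp v)⁻¹ := by
  funext i; simp [torusExp]

theorem torusExp_surjective : Function.Surjective (torusExp : (Fin k → ℝ) → Torus k) := fun t =>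
  ⟨fun i => (t i : ℂ).arg, by funext i; simp [torusExp, Circle.exp_arg]⟩

theorem continuous_torusExp : Continuous (torusExp : (Fin k → ℝ) → Torus k) :=
  continuous_pi fun i => Circle.exp.continuous.comp (continuous_apply i)

theorem isOpenQuotientMap_torusExp :
    IsOpenQuotientMap (torusExp : (Fin k → ℝ) → Torus k) where
  surjective := torusExp_surjective
  continuous := continuous_torusExp
  isOpenMap := by
    have h : IsOpenMap (Pi.map (fun _ : Fin k => (Circle.exp : ℝ → Circle))) :=
      IsOpenMap.piMap (fun _ => isLocalHomeomorph_circleExp.isOpenMap)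
        (Filter.Eventually.of_forall fun _ => Circle.exp_surjective)
    exact h

/-- The differential of a character: an integral linear form. -/
theorem exists_int_vector_of_character (α : Torus k →ₜ* Circle) :
    ∃ m : Fin k → ℤ, ∀ v, α (torusExp v) = Circle.exp (∑ j, (m j : ℝ) * v j) := by
  have h1 : ∀ j : Fin k, ∃ a : ℝ, ∀ t, α (torusExp (Pi.single j t)) = Circle.exp (a * t) := by
    intro j
    apply Circle.exists_eq_exp_of_continuous_of_map_add
      (χ := fun t => α (torusExp (Pi.single j t)))
    · exact α.continuous_toFun.comp (continuous_torusExp.comp (continuous_single (A := fun _ : Fin k => ℝ) j))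
    · intro s t
      rw [Pi.single_add, torusExp_add, map_mul]
  choose a ha using h1
  have h2 : ∀ j, ∃ m : ℤ, a j = m := by
    intro j
    have h := ha j (2 * Real.pi)
    have h3 : torusExp (Pi.single j (2 * Real.pi)) = (1 : Torus k) := by
      funext i
      rcases eq_or_ne i j with rfl | hij
      · simp [torusExp]
      · simp [torusExp, Pi.single_eq_of_ne hij]
    rw [h3, map_one] at h
    obtain ⟨m, hm⟩ := Circle.exp_eq_one.1 h.symm
    exact ⟨m, mul_right_cancel₀ (by positivity) hm⟩
  choose m hm using h2
  refine ⟨m, fun v => ?_⟩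
  have h4 : ∀ s : Finset (Fin k), α (torusExp (∑ j ∈ s, Pi.single j (v j))) =
      Circle.exp (∑ j ∈ s, (m j : ℝ) * v j) := by
    intro s
    classical
    induction s using Finset.induction_on with
    | empty => simp
    | insert j s hj ih =>
      rw [Finset.sum_insert hj, Finset.sum_insert hj, torusExp_add, map_mul, ih, Circle.exp_add,
        ha, hm]
  have h5 := h4 Finset.univ
  rwa [Finset.univ_sum_single] at h5

/-- The integral vector of a character of the torus. -/
noncomputable def charVec (α : Torus k →ₜ* Circle) : Fin k → ℤ :=
  (exists_int_vector_of_character α).choose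

/-- The differential of a character of the torus, as a linear form. -/
noncomputable def charForm (α : Torus k →ₜ* Circle) : (Fin k → ℝ) →L[ℝ] ℝ :=
  ∑ j, (charVec α j : ℝ) • ContinuousLinearMap.proj j

theorem charForm_apply (α : Torus k →ₜ* Circle) (v : Fin k → ℝ) :
    charForm α v = ∑ j, (charVec α j : ℝ) * v j := by
  simp [charForm]

theorem character_torusExp (α : Torus k →ₜ* Circle) (v : Fin k → ℝ) :
    α (torusExp v) = Circle.exp (charForm α v) := by
  rw [charForm_apply]
  exact (exists_int_vector_of_character α).choose_spec v

/-- Differentiate `s ↦ exp (i s b)` at 0. Small `s` suffice, which matters when only a short piece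
of a one-parameter subgroup is known to fix a point. -/
theorem eq_zero_of_forall_exp_eq_one {b : ℝ} {ε : ℝ} (hε : 0 < ε)
    (h : ∀ s : ℝ, |s| < ε → Circle.exp (s * b) = 1) : b = 0 := by
  have h1 : HasDerivAt (fun s : ℝ => Complex.exp ((s * b : ℝ) * Complex.I)) (b * Complex.I) 0 := by
    have h2 : HasDerivAt (fun s : ℝ => ((s * b : ℝ) : ℂ) * Complex.I) (b * Complex.I) 0 := by
      have : HasDerivAt (fun s : ℝ => s * b) b 0 := by simpa using (hasDerivAt_id (0:ℝ)).mul_const b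
      exact this.ofReal_comp.mul_const _
    simpa using h2.cexp
  have h2 : HasDerivAt (fun s : ℝ => Complex.exp ((s * b : ℝ) * Complex.I)) 0 0 := by
    refine (hasDerivAt_const (0 : ℝ) (1 : ℂ)).congr_of_eventuallyEq ?_
    filter_upwards [Metric.ball_mem_nhds (0 : ℝ) hε] with s hs
    have h3 := h s (by simpa using hs)
    rw [← Circle.coe_exp, h3, Circle.coe_one]
  have h3 := h1.unique h2
  simpa using h3

theorem charForm_eq_of_eq {α : Torus k →ₜ* Circle} {l : (Fin k → ℝ) →L[ℝ] ℝ}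
    (h : ∀ v, α (torusExp v) = Circle.exp (l v)) : charForm α = l := by
  ext v
  rw [← sub_eq_zero]
  refine eq_zero_of_forall_exp_eq_one one_pos fun s _ => ?_
  have h1 := character_torusExp α (s • v)
  rw [h (s • v)] at h1
  rw [mul_sub, Circle.exp_sub]
  simp only [map_smul, smul_eq_mul] at h1
  rw [h1, div_self']

theorem charVec_eq_of_charForm_eq {α : Torus k →ₜ* Circle} {m : Fin k → ℤ}
    (h : ∀ v, charForm α v = ∑ j, (m j : ℝ) * v j) : charVec α = m := by
  funext i
  have h1 := h (Pi.single i 1)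
  rw [charForm_apply] at h1
  simpa [Pi.single_apply] using h1

theorem charForm_mul (α β : Torus k →ₜ* Circle) :
    charForm (α * β) = charForm α + charForm β := by
  apply charForm_eq_of_eq
  intro v
  rw [ContinuousMonoidHom.mul_apply, character_torusExp, character_torusExp]
  simp [Circle.exp_add]

theorem charVec_mul (α β : Torus k →ₜ* Circle) : charVec (α * β) = charVec α + charVec β := by
  refine charVec_eq_of_charForm_eq fun v => ?_
  rw [charForm_mul]
  simp [charForm_apply, add_mul, Finset.sum_add_distrib]

/-- Sending a character to its integral vector, as a `ℤ`-linear map. -/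
noncomputable def charVecHom (k : ℕ) : Additive (Torus k →ₜ* Circle) →ₗ[ℤ] (Fin k → ℤ) :=
  (AddMonoidHom.mk' (fun a => charVec (Additive.toMul a))
    (fun _ _ => charVec_mul _ _)).toIntLinearMap

theorem charVec_injective : Function.Injective (charVec : (Torus k →ₜ* Circle) → _) := by
  intro α β h
  ext t
  obtain ⟨v, rfl⟩ := torusExp_surjective t
  rw [character_torusExp, character_torusExp, charForm_apply, charForm_apply, h]

theorem charVecHom_injective : Function.Injective (charVecHom k) := fun _ _ h =>
  Additive.toMul.injective (charVec_injective h)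

/-- Integral vectors which are independent over `ℤ` define a surjective real linear map. -/
theorem exists_rightInverse_of_linearIndependent_int {ι : Type*} [Fintype ι]
    {m : ι → Fin k → ℤ} (h : LinearIndependent ℤ m) :
    ∃ B : (ι → ℝ) →L[ℝ] (Fin k → ℝ), ∀ (θ : ι → ℝ) (i : ι), ∑ j, (m i j : ℝ) * B θ j = θ i := by
  classical
  set M : Matrix ι (Fin k) ℤ := Matrix.of m with hM
  -- An integral kernel vector `v` of the Gram matrix satisfies `|Mᵀ v|² = 0`, a relation among the
  -- rows. The right inverse is then `Rᵀ (R Rᵀ)⁻¹`.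
  have hdet : (M * M.transpose).det ≠ 0 := by
    intro h0
    obtain ⟨v, hv, hv0⟩ := Matrix.exists_mulVec_eq_zero_iff.2 h0
    have h1 : M.transpose.mulVec v = 0 := by
      have h2 : dotProduct (M.transpose.mulVec v) (M.transpose.mulVec v) = 0 := by
        rw [Matrix.dotProduct_mulVec, Matrix.vecMul_transpose, Matrix.mulVec_mulVec, hv0,
          zero_dotProduct]
      exact dotProduct_self_eq_zero.1 h2
    apply hv
    have h3 := Fintype.linearIndependent_iff.1 h v
    funext i
    refine h3 ?_ i
    funext j
    have h4 := congrFun h1 j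
    simp only [Matrix.mulVec, dotProduct, Matrix.transpose_apply, hM, Matrix.of_apply,
      Pi.zero_apply] at h4
    simp only [Finset.sum_apply, Pi.smul_apply, smul_eq_mul, Pi.zero_apply]
    rw [← h4]
    exact Finset.sum_congr rfl fun i _ => mul_comm _ _
  set R : Matrix ι (Fin k) ℝ := M.map (Int.castRingHom ℝ) with hR
  have hdetR : IsUnit (R * R.transpose).det := by
    have h1 : R * R.transpose = (M * M.transpose).map (Int.castRingHom ℝ) := by
      rw [hR, Matrix.map_mul, Matrix.transpose_map]
    rw [h1, ← RingHom.mapMatrix_apply, ← RingHom.map_det, isUnit_iff_ne_zero]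
    simpa using hdet
  set B := R.transpose * (R * R.transpose)⁻¹ with hB
  have hRB : R * B = 1 := by
    rw [hB, ← Matrix.mul_assoc, Matrix.mul_nonsing_inv _ hdetR]
  refine ⟨LinearMap.toContinuousLinearMap (Matrix.toLin' B), fun θ i => ?_⟩
  have h1 : R.mulVec (B.mulVec θ) = θ := by
    rw [Matrix.mulVec_mulVec, hRB, Matrix.one_mulVec]
  have h2 := congrFun h1 i
  rw [← h2]
  simp [Matrix.mulVec, dotProduct, hR, hM]

/-- Independent characters have a common linear section of their differentials. -/
theorem exists_section_of_linearIndependent_characters {ι : Type*} [Fintype ι]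
    {β : ι → (Torus k →ₜ* Circle)}
    (h : LinearIndependent ℤ fun i => Additive.ofMul (β i)) :
    ∃ B : (ι → ℝ) →L[ℝ] (Fin k → ℝ), ∀ (θ : ι → ℝ) (i : ι), charForm (β i) (B θ) = θ i := by
  have h1 : LinearIndependent ℤ fun i => charVec (β i) :=
    h.map' (charVecHom k) (LinearMap.ker_eq_bot.2 charVecHom_injective)
  obtain ⟨B, hB⟩ := exists_rightInverse_of_linearIndependent_int h1
  exact ⟨B, fun θ i => by rw [charForm_apply]; exact hB θ i⟩

/-- Finitely many characters have the same common kernel as some independent family. -/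
theorem exists_linearIndependent_characters_same_kernel {ι : Type*} [Finite ι]
    (α : ι → (Torus k →ₜ* Circle)) :
    ∃ (p : ℕ) (β : Fin p → (Torus k →ₜ* Circle)),
      (LinearIndependent ℤ fun i => Additive.ofMul (β i)) ∧
        ∀ t, (∀ i, β i t = 1) ↔ ∀ i, α i t = 1 := by
  -- The character group embeds in `ℤ^k`, so the subgroup generated by the `αᵢ` is free; the `βᵢ`
  -- are a basis of it.
  have hfree : Module.Free ℤ (Additive (Torus k →ₜ* Circle)) := by
    obtain ⟨n, ⟨b⟩⟩ := Submodule.nonempty_basis_of_pid (Pi.basisFun ℤ (Fin k))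
      (LinearMap.range (charVecHom k))
    have : Module.Free ℤ (LinearMap.range (charVecHom k)) := Module.Free.of_basis b
    exact Module.Free.of_equiv (LinearEquiv.ofInjective _ charVecHom_injective).symm
  have hfin : Module.Finite ℤ (Additive (Torus k →ₜ* Circle)) :=
    Module.Finite.of_injective _ charVecHom_injective
  obtain ⟨p, ⟨b⟩⟩ := Submodule.nonempty_basis_of_pid
    (Module.Free.chooseBasis ℤ (Additive (Torus k →ₜ* Circle)))
    (Submodule.span ℤ (Set.range fun i => Additive.ofMul (α i)))
  refine ⟨p, fun i => Additive.toMul (b i : Additive (Torus k →ₜ* Circle)), ?_, fun t => ?_⟩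
  · exact b.linearIndependent.map' (Submodule.subtype _) (Submodule.ker_subtype _)
  · set K : Submodule ℤ (Additive (Torus k →ₜ* Circle)) :=
      AddSubgroup.toIntSubmodule
        { carrier := {a | Additive.toMul a t = 1}
          zero_mem' := rfl
          add_mem' := by
            intro a b ha hb
            simp only [Set.mem_ofPred_eq, toMul_add, ContinuousMonoidHom.mul_apply] at *
            rw [ha, hb, one_mul]
          neg_mem' := by
            intro a ha
            simp only [Set.mem_ofPred_eq, toMul_neg] at *
            rw [show ((Additive.toMul a)⁻¹) t = (Additive.toMul a t)⁻¹ from rfl, ha, inv_one] }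
      with hK
    constructor
    · intro h i
      have hspan : Submodule.span ℤ (Set.range fun i => Additive.ofMul (α i)) ≤ K := by
        rw [← Submodule.map_subtype_top (Submodule.span ℤ _), ← b.span_eq, Submodule.map_span,
          Submodule.span_le]
        rintro _ ⟨_, ⟨j, rfl⟩, rfl⟩
        exact h j
      exact hspan (Submodule.subset_span ⟨i, rfl⟩)
    · intro h i
      have hspan : Submodule.span ℤ (Set.range fun i => Additive.ofMul (α i)) ≤ K := by
        rw [Submodule.span_le]
        rintro _ ⟨j, rfl⟩
        exact h j
      exact hspan (b i).2

end Characters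

/-! ### The orbit space of a linear action in general position -/

section LinearModel

open Filter Topology

theorem Circle.isInducing_coe : Topology.IsInducing (fun u : Circle => (u : ℂ)) :=
  ⟨rfl⟩

/-- The phase of a complex number (with value `1` at `0`). -/
noncomputable def phase (z : ℂ) : Circle := Circle.exp z.arg

theorem norm_mul_phase (z : ℂ) : (‖z‖ : ℂ) * phase z = z := by
  rw [phase, Circle.coe_exp, Complex.norm_mul_exp_arg_mul_I]

theorem coe_phase {z : ℂ} (hz : z ≠ 0) : (phase z : ℂ) = z / ‖z‖ := by
  rw [eq_div_iff (by simpa using hz), mul_comm, norm_mul_phase]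

theorem phase_circle_mul (u : Circle) {z : ℂ} (hz : z ≠ 0) : phase (u * z) = u * phase z := by
  apply Circle.ext
  rw [coe_phase (mul_ne_zero (Circle.coe_ne_zero u) hz), Circle.coe_mul, coe_phase hz, norm_mul,
    Circle.norm_coe, one_mul, mul_div_assoc]

theorem phase_ofReal_mul {r : ℝ} (hr : 0 < r) (u : Circle) : phase (r * u) = u := by
  apply Circle.ext
  have hr' : (r : ℂ) ≠ 0 := by exact_mod_cast hr.ne'
  rw [coe_phase (mul_ne_zero hr' (Circle.coe_ne_zero u)), norm_mul, Circle.norm_coe, mul_one,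
    Complex.norm_real, Real.norm_of_nonneg hr.le]
  field_simp

theorem continuousAt_phase {z : ℂ} (hz : z ≠ 0) : ContinuousAt phase z := by
  rw [Circle.isInducing_coe.continuousAt_iff]
  have h : ContinuousAt (fun z : ℂ => z / (‖z‖ : ℂ)) z :=
    continuousAt_id.div (Complex.continuous_ofReal.continuousAt.comp continuous_norm.continuousAt)
      (by simpa using hz)
  refine h.congr ?_
  filter_upwards [isOpen_ne.mem_nhds hz] with w hw
  exact (coe_phase hw).symm

theorem Circle.exists_zpow_eq {c : ℤ} (hc : c ≠ 0) (u : Circle) : ∃ v : Circle, v ^ c = u := by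
  refine ⟨Circle.exp ((u : ℂ).arg / c), ?_⟩
  rw [← Circle.exp_intCast_mul, mul_div_cancel₀ _ (by exact_mod_cast hc), Circle.exp_arg]

variable {n : ℕ}

/-- The smallest modulus of the coordinates of a vector. -/
noncomputable def minNorm (i₀ : Fin n) (z : Fin n → ℂ) : ℝ :=
  Finset.univ.inf' ⟨i₀, Finset.mem_univ _⟩ fun i => ‖z i‖

theorem minNorm_le (i₀ : Fin n) (z : Fin n → ℂ) (i : Fin n) : minNorm i₀ z ≤ ‖z i‖ :=
  Finset.inf'_le _ (Finset.mem_univ i)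

theorem exists_minNorm_eq (i₀ : Fin n) (z : Fin n → ℂ) : ∃ i, minNorm i₀ z = ‖z i‖ := by
  obtain ⟨i, -, hi⟩ := Finset.exists_mem_eq_inf' ⟨i₀, Finset.mem_univ i₀⟩ fun i => ‖z i‖
  exact ⟨i, hi⟩

theorem minNorm_nonneg (i₀ : Fin n) (z : Fin n → ℂ) : 0 ≤ minNorm i₀ z := by
  obtain ⟨i, hi⟩ := exists_minNorm_eq i₀ z
  rw [hi]; exact norm_nonneg _

theorem continuous_minNorm (i₀ : Fin n) : Continuous (minNorm i₀) := by
  unfold minNorm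
  exact Continuous.finset_inf'_apply _ fun i _ => (continuous_apply i).norm

/-- The invariant map `ℂⁿ → ℝⁿ⁻¹ × ℂ` of the subtorus `∏ uᵢ ^ cᵢ = 1`. -/
noncomputable def modelMap (c : Fin n → ℤ) (i₀ : Fin n) (z : Fin n → ℂ) :
    ({i : Fin n // i ≠ i₀} → ℝ) × ℂ :=
  (fun i => ‖z i‖ - ‖z i₀‖, minNorm i₀ z * ((∏ i, phase (z i) ^ c i : Circle) : ℂ))

theorem norm_modelMap_snd (c : Fin n → ℤ) (i₀ : Fin n) (z : Fin n → ℂ) :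
    ‖(modelMap c i₀ z).2‖ = minNorm i₀ z := by
  rw [modelMap, norm_mul, Circle.norm_coe, mul_one, Complex.norm_real,
    Real.norm_of_nonneg (minNorm_nonneg _ _)]

/-- The phase product can jump only where a coordinate vanishes, and there its factor `minNorm`
tends to 0. -/
theorem continuous_modelMap (c : Fin n → ℤ) (i₀ : Fin n) : Continuous (modelMap c i₀) := by
  refine Continuous.prodMk ?_ ?_
  · exact continuous_pi fun i =>
      (continuous_apply (i : Fin n)).norm.sub (continuous_apply i₀).norm
  · rw [continuous_iff_continuousAt]
    intro z
    by_cases h : minNorm i₀ z = 0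
    · have h1 : ((minNorm i₀ z : ℝ) : ℂ) * ((∏ i, phase (z i) ^ c i : Circle) : ℂ) = 0 := by
        rw [h]; simp
      change Tendsto _ _ (𝓝 (((minNorm i₀ z : ℝ) : ℂ) * ((∏ i, phase (z i) ^ c i : Circle) : ℂ)))
      rw [h1, tendsto_zero_iff_norm_tendsto_zero]
      have h2 : (fun z => ‖((minNorm i₀ z : ℝ) : ℂ) * ((∏ i, phase (z i) ^ c i : Circle) : ℂ)‖) =
          minNorm i₀ := funext fun z => norm_modelMap_snd c i₀ z
      rw [h2, ← h]
      exact (continuous_minNorm i₀).continuousAt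
    · have hz : ∀ i, z i ≠ 0 := by
        intro i hi
        have h1 := minNorm_le i₀ z i
        rw [hi, norm_zero] at h1
        exact h (le_antisymm h1 (minNorm_nonneg _ _))
      refine (Complex.continuous_ofReal.comp (continuous_minNorm i₀)).continuousAt.mul ?_
      refine Circle.isInducing_coe.continuous.continuousAt.comp ?_
      refine tendsto_finsetProd _ fun i _ => ?_
      have h1 : ContinuousAt (fun z : Fin n → ℂ => phase (z i)) z :=
        ContinuousAt.comp (f := fun z : Fin n → ℂ => z i) (continuousAt_phase (hz i))
          (continuous_apply i).continuousAt
      exact h1.zpow (c i)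

/-- If `j` has the smallest modulus, then `‖z i‖` is the difference for `i`, minus the difference
for `j`, plus `minNorm`: three terms, each at most the norm of the image. This yields properness. -/
theorem norm_le_norm_modelMap (c : Fin n → ℤ) (i₀ : Fin n) (z : Fin n → ℂ) :
    ‖z‖ ≤ 3 * ‖modelMap c i₀ z‖ := by
  set q := modelMap c i₀ z with hq
  have h2 : minNorm i₀ z ≤ ‖q‖ := by
    rw [← norm_modelMap_snd c]; exact norm_snd_le q
  have h1 : ∀ i, |‖z i‖ - ‖z i₀‖| ≤ ‖q‖ := by
    intro i
    by_cases hi : i = i₀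
    · rw [hi]; simp
    · exact (norm_le_pi_norm q.1 ⟨i, hi⟩).trans (norm_fst_le q)
  obtain ⟨j, hj⟩ := exists_minNorm_eq i₀ z
  refine (pi_norm_le_iff_of_nonneg (by positivity)).2 fun i => ?_
  have h3 := abs_le.1 (h1 j)
  have h4 := abs_le.1 (h1 i)
  linarith

theorem isClosedMap_modelMap (c : Fin n → ℤ) (i₀ : Fin n) : IsClosedMap (modelMap c i₀) := by
  have h : IsProperMap (modelMap c i₀) := by
    rw [isProperMap_iff_tendsto_cocompact]
    refine ⟨continuous_modelMap c i₀, ?_⟩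
    rw [← Metric.cobounded_eq_cocompact, ← Metric.cobounded_eq_cocompact,
      ← tendsto_norm_atTop_iff_cobounded]
    refine tendsto_atTop_mono (f := fun z : Fin n → ℂ => ‖z‖ / 3) (fun z => ?_)
      (tendsto_norm_cobounded_atTop.atTop_div_const (by norm_num))
    have := norm_le_norm_modelMap c i₀ z
    linarith
  exact h.isClosedMap

/-- The moduli are the prescribed differences shifted so that their minimum is `‖w‖`; the whole
phase goes into coordinate `i₀`, as a `c i₀`-th root of the phase of `w`. -/
theorem surjective_modelMap {c : Fin n → ℤ} {i₀ : Fin n} (hc : c i₀ ≠ 0) :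
    Function.Surjective (modelMap c i₀) := by
  classical
  rintro ⟨a, w⟩
  set b : Fin n → ℝ := fun i => if h : i = i₀ then 0 else a ⟨i, h⟩ with hb
  have hb0 : b i₀ = 0 := by simp [hb]
  obtain ⟨j, -, hj⟩ := Finset.exists_mem_eq_inf' ⟨i₀, Finset.mem_univ i₀⟩ b
  have hjle : ∀ i, b j ≤ b i := fun i => hj ▸ Finset.inf'_le _ (Finset.mem_univ i)
  obtain ⟨v, hv⟩ := Circle.exists_zpow_eq hc (phase w)
  set r : Fin n → ℝ := fun i => ‖w‖ + (b i - b j) with hr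
  have hr0 : ∀ i, 0 ≤ r i := fun i => add_nonneg (norm_nonneg _) (sub_nonneg.2 (hjle i))
  set u : Fin n → Circle := fun i => if i = i₀ then v else 1 with hu
  set z : Fin n → ℂ := fun i => r i * u i with hz
  have hzn : ∀ i, ‖z i‖ = r i := fun i => by
    rw [hz]
    simp only [norm_mul, Circle.norm_coe, mul_one, Complex.norm_real,
      Real.norm_of_nonneg (hr0 i)]
  have hmin : minNorm i₀ z = ‖w‖ := by
    apply le_antisymm
    · refine (minNorm_le i₀ z j).trans ?_
      rw [hzn, hr]; simp
    · obtain ⟨i, hi⟩ := exists_minNorm_eq i₀ z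
      rw [hi, hzn, hr]
      simpa using hjle i
  refine ⟨z, Prod.ext (funext fun i => ?_) ?_⟩
  · simp only [modelMap, hzn, hr, hb0]
    have : b i = a i := by simp [hb, i.2]
    rw [this]; ring
  · simp only [modelMap, hmin]
    by_cases hw : w = 0
    · simp [hw]
    · have hph : ∀ i, phase (z i) = u i := fun i => by
        apply phase_ofReal_mul
        exact add_pos_of_pos_of_nonneg (norm_pos_iff.2 hw) (sub_nonneg.2 (hjle i))
      have : ∏ i, phase (z i) ^ c i = phase w := by
        rw [Finset.prod_eq_single i₀]
        · rw [hph]; simp [hu, hv]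
        · intro i _ hi
          rw [hph]; simp [hu, hi]
        · simp
      rw [this, norm_mul_phase]

theorem modelMap_eq_of_circle_mul {c : Fin n → ℤ} {i₀ : Fin n} {z z' : Fin n → ℂ}
    {u : Fin n → Circle} (hu : ∏ i, u i ^ c i = 1) (h : ∀ i, z' i = u i * z i) :
    modelMap c i₀ z' = modelMap c i₀ z := by
  have hn : ∀ i, ‖z' i‖ = ‖z i‖ := fun i => by rw [h, norm_mul, Circle.norm_coe, one_mul]
  have hmin : minNorm i₀ z' = minNorm i₀ z := by simp only [minNorm, hn]
  refine Prod.ext (funext fun i => ?_) ?_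
  · simp only [modelMap, hn]
  · simp only [modelMap, hmin]
    by_cases h0 : ∃ i, z i = 0
    · obtain ⟨i, hi⟩ := h0
      have h1 : minNorm i₀ z = 0 := by
        refine le_antisymm ?_ (minNorm_nonneg _ _)
        have := minNorm_le i₀ z i
        rwa [hi, norm_zero] at this
      rw [h1]; simp
    · push Not at h0
      have : ∏ i, phase (z' i) ^ c i = ∏ i, phase (z i) ^ c i := by
        calc ∏ i, phase (z' i) ^ c i = ∏ i, (u i ^ c i * phase (z i) ^ c i) := by
              refine Finset.prod_congr rfl fun i _ => ?_
              rw [h, phase_circle_mul _ (h0 i), mul_zpow]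
          _ = _ := by rw [Finset.prod_mul_distrib, hu, one_mul]
      rw [this]

theorem exists_circle_mul_of_modelMap_eq {c : Fin n → ℤ} (hc : ∀ i, c i ≠ 0) {i₀ : Fin n}
    {z z' : Fin n → ℂ} (h : modelMap c i₀ z' = modelMap c i₀ z) :
    ∃ u : Fin n → Circle, ∏ i, u i ^ c i = 1 ∧ ∀ i, z' i = u i * z i := by
  classical
  have hmin : minNorm i₀ z' = minNorm i₀ z := by
    rw [← norm_modelMap_snd c, h, norm_modelMap_snd]
  have hd : ∀ i, ‖z' i‖ - ‖z' i₀‖ = ‖z i‖ - ‖z i₀‖ := by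
    intro i
    by_cases hi : i = i₀
    · rw [hi]; simp
    · exact congrFun (congrArg Prod.fst h) ⟨i, hi⟩
  have hn : ∀ i, ‖z' i‖ = ‖z i‖ := by
    obtain ⟨j, hj⟩ := exists_minNorm_eq i₀ z
    obtain ⟨j', hj'⟩ := exists_minNorm_eq i₀ z'
    have h1 := minNorm_le i₀ z j'
    have h2 := minNorm_le i₀ z' j
    intro i
    have h3 := hd i
    have h4 := hd j
    have h5 := hd j'
    linarith
  -- At a zero coordinate `j` the factor `u j` is arbitrary, so it can be chosen to satisfy the
  -- relation, because `c j ≠ 0`. Without zeros the second component of `modelMap` gives the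
  -- relation.
  by_cases h0 : ∃ i, z i = 0
  · obtain ⟨j, hj⟩ := h0
    set u₀ : Fin n → Circle := fun i => phase (z' i) * (phase (z i))⁻¹ with hu₀
    obtain ⟨v, hv⟩ := Circle.exists_zpow_eq (hc j) (∏ i ∈ Finset.univ.erase j, u₀ i ^ c i)⁻¹
    refine ⟨Function.update u₀ j v, ?_, fun i => ?_⟩
    · rw [← Finset.mul_prod_erase _ _ (Finset.mem_univ j)]
      rw [Function.update_self, hv]
      rw [inv_mul_eq_one]
      refine Finset.prod_congr rfl fun i hi => ?_
      rw [Function.update_of_ne (Finset.ne_of_mem_erase hi)]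
    · by_cases hi : i = j
      · subst hi
        have := hn i
        rw [hj, norm_zero, norm_eq_zero] at this
        rw [this, hj, mul_zero]
      · rw [Function.update_of_ne hi]
        conv_lhs => rw [← norm_mul_phase (z' i), hn]
        conv_rhs => rw [← norm_mul_phase (z i)]
        simp only [hu₀, Circle.coe_mul, Circle.coe_inv]
        field_simp [Circle.coe_ne_zero]
  · push Not at h0
    refine ⟨fun i => phase (z' i) * (phase (z i))⁻¹, ?_, fun i => ?_⟩
    · have hpos : minNorm i₀ z ≠ 0 := by
        obtain ⟨j, hj⟩ := exists_minNorm_eq i₀ z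
        rw [hj]; exact norm_ne_zero_iff.2 (h0 j)
      have h2 := congrArg Prod.snd h
      simp only [modelMap, hmin] at h2
      have h3 := mul_left_cancel₀ (by exact_mod_cast hpos) h2
      have h4 : ∏ i, phase (z' i) ^ c i = ∏ i, phase (z i) ^ c i := Circle.ext h3
      simp only [mul_zpow, inv_zpow, Finset.prod_mul_distrib, Finset.prod_inv_distrib, h4,
        mul_inv_cancel]
    · conv_lhs => rw [← norm_mul_phase (z' i), hn]
      conv_rhs => rw [← norm_mul_phase (z i)]
      simp only [Circle.coe_mul, Circle.coe_inv]
      field_simp [Circle.coe_ne_zero]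

/-- `n` weights of a torus of rank `n - 1` in general position: the image of the torus in `(S¹)ⁿ`
is the kernel of a single character all of whose exponents are nonzero. -/
theorem exists_relation_of_generalPosition (hn : 1 ≤ n)
    {α : Fin n → (Torus (n - 1) →ₜ* Circle)} (hα : WeightsInGeneralPosition α) :
    ∃ c : Fin n → ℤ, (∀ i, c i ≠ 0) ∧ (∀ t, ∏ i, α i t ^ c i = 1) ∧
      ∀ u : Fin n → Circle, ∏ i, u i ^ c i = 1 → ∃ t, ∀ i, α i t = u i := by
  classical
  have hvec : ∀ j : Fin n, LinearIndependent ℤ fun i : {i : Fin n // i ≠ j} => charVec (α i) :=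
    fun j => (hα j).map' (charVecHom (n - 1)) (LinearMap.ker_eq_bot.2 charVecHom_injective)
  have hdep : ¬ LinearIndependent ℤ fun i => charVec (α i) := by
    intro h
    have := h.fintype_card_le_finrank
    simp at this
    omega
  obtain ⟨g₀, hg₀, i₁, hi₁⟩ := Fintype.not_linearIndependent_iff.1 hdep
  set i₀ : Fin n := ⟨0, hn⟩
  -- Dividing by the gcd is essential: for a non-primitive relation the group `∏ uᵢ ^ cᵢ = 1` would
  -- be disconnected and larger than the image of the torus.
  obtain ⟨c, hc, hgcd⟩ := Finset.extract_gcd (s := Finset.univ) g₀ ⟨i₀, Finset.mem_univ i₀⟩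
  have hd0 : Finset.univ.gcd g₀ ≠ 0 := fun h0 => hi₁ (by rw [hc i₁ (Finset.mem_univ _), h0, zero_mul])
  have hrel : ∑ i, c i • charVec (α i) = 0 := by
    have h1 : Finset.univ.gcd g₀ • ∑ i, c i • charVec (α i) = 0 := by
      rw [← hg₀, Finset.smul_sum]
      refine Finset.sum_congr rfl fun i _ => ?_
      conv_rhs => rw [hc i (Finset.mem_univ _), mul_smul]
    exact (smul_eq_zero.1 h1).resolve_left hd0
  have hc0 : ∃ i, c i ≠ 0 := ⟨i₁, fun h0 => hi₁ (by rw [hc i₁ (Finset.mem_univ _), h0, mul_zero])⟩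
  have hcne : ∀ j, c j ≠ 0 := by
    intro j hj
    have h1 : ∑ i : {i : Fin n // i ≠ j}, c i • charVec (α i) = 0 := by
      rw [← Finset.sum_subtype (Finset.univ.erase j) (fun i => by simp)
        (fun i => c i • charVec (α i)), ← hrel,
        ← Finset.add_sum_erase Finset.univ (fun i => c i • charVec (α i)) (Finset.mem_univ j), hj,
        zero_smul, zero_add]
    obtain ⟨i, hi⟩ := hc0
    have hij : i ≠ j := fun h => hi (h ▸ hj)
    exact hi (Fintype.linearIndependent_iff.1 (hvec j) (fun i => c i) h1 ⟨i, hij⟩)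
  have hform : ∀ v, ∑ i, (c i : ℝ) * charForm (α i) v = 0 := by
    intro v
    have h1 : ∀ j, ∑ i, (c i : ℝ) * (charVec (α i) j : ℝ) = 0 := by
      intro j
      have := congrFun hrel j
      simp only [Finset.sum_apply, Pi.smul_apply, smul_eq_mul, Pi.zero_apply] at this
      exact_mod_cast this
    simp only [charForm_apply, Finset.mul_sum]
    rw [Finset.sum_comm]
    refine Finset.sum_eq_zero fun j _ => ?_
    rw [← zero_mul (v j), ← h1 j, Finset.sum_mul]
    exact Finset.sum_congr rfl fun i _ => by ring
  have hprodexp : ∀ θ : Fin n → ℝ, ∏ i, Circle.exp (θ i) ^ c i = Circle.exp (∑ i, c i * θ i) := by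
    intro θ
    have : ∀ s : Finset (Fin n), ∏ i ∈ s, Circle.exp (θ i) ^ c i =
        Circle.exp (∑ i ∈ s, c i * θ i) := by
      intro s
      induction s using Finset.induction_on with
      | empty => simp
      | insert j s hj ih =>
        rw [Finset.prod_insert hj, Finset.sum_insert hj, ih, Circle.exp_add,
          Circle.exp_intCast_mul]
    exact this _
  refine ⟨c, hcne, fun t => ?_, fun u hu => ?_⟩
  · obtain ⟨v, rfl⟩ := torusExp_surjective t
    simp only [character_torusExp]
    rw [hprodexp, hform, Circle.exp_zero]
  · choose θ₀ hθ₀ using fun i => Circle.exp_surjective (u i)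
    obtain ⟨m, hm⟩ : ∃ m : ℤ, ∑ i, c i * θ₀ i = m * (2 * Real.pi) := by
      apply Circle.exp_eq_one.1
      rw [← hprodexp, ← hu]
      simp only [hθ₀]
    -- Bézout coefficients correct the angles by multiples of `2π` so that their weighted sum is
    -- exactly 0, not just 0 modulo `2π`.
    obtain ⟨b, hb⟩ : ∃ b : Fin n → ℤ, ∑ i, c i * b i = 1 := by
      obtain ⟨b, hb⟩ := Finset.gcd_eq_sum_mul (s := Finset.univ) c
      exact ⟨b, by rw [← hb, hgcd]⟩
    set θ : Fin n → ℝ := fun i => θ₀ i - (m * b i : ℤ) * (2 * Real.pi) with hθ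
    have hθu : ∀ i, Circle.exp (θ i) = u i := by
      intro i
      rw [hθ]
      simp only
      rw [Circle.exp_sub, Circle.exp_int_mul_two_pi, hθ₀, div_one]
    have hθ0 : ∑ i, c i * θ i = 0 := by
      have hb' : ∑ i, (c i : ℝ) * b i = 1 := by exact_mod_cast hb
      have : ∀ i, (c i : ℝ) * θ i = c i * θ₀ i - (c i * b i) * (m * (2 * Real.pi)) := by
        intro i; simp only [hθ]; push_cast; ring
      simp only [this, Finset.sum_sub_distrib, ← Finset.sum_mul, hb', hm]
      ring
    -- Solve for the `n - 1` angles other than `i₀`; the linear relation then forces the last one.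
    obtain ⟨B, hB⟩ := exists_section_of_linearIndependent_characters (hα i₀)
    set v := B fun i => θ i with hv
    have h1 : ∀ i, i ≠ i₀ → charForm (α i) v = θ i := fun i hi => hB (fun i => θ i) ⟨i, hi⟩
    have h2 : charForm (α i₀) v = θ i₀ := by
      have h3 := hform v
      rw [← hθ0, ← Finset.add_sum_erase _ _ (Finset.mem_univ i₀),
        ← Finset.add_sum_erase (a := i₀) _ (fun i => (c i : ℝ) * θ i) (Finset.mem_univ i₀)] at h3
      have h4 : ∑ i ∈ Finset.univ.erase i₀, (c i : ℝ) * charForm (α i) v =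
          ∑ i ∈ Finset.univ.erase i₀, (c i : ℝ) * θ i :=
        Finset.sum_congr rfl fun i hi => by rw [h1 i (Finset.ne_of_mem_erase hi)]
      rw [h4] at h3
      exact mul_left_cancel₀ (by exact_mod_cast hcne i₀) (add_right_cancel h3)
    refine ⟨torusExp v, fun i => ?_⟩
    rw [character_torusExp, ← hθu]
    by_cases hi : i = i₀
    · rw [hi, h2]
    · rw [h1 i hi]

/-- For weights in general position there is a continuous open map `ℂⁿ → ℝⁿ⁺¹` whose fibres are the
orbits of the torus. -/
theorem exists_open_orbit_map (hn : 1 ≤ n)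
    {α : Fin n → (Torus (n - 1) →ₜ* Circle)} (hα : WeightsInGeneralPosition α) :
    ∃ Q : (Fin n → ℂ) → EuclideanSpace ℝ (Fin (n + 1)), Continuous Q ∧ IsOpenMap Q ∧
      ∀ z z', Q z' = Q z ↔ ∃ t, ∀ i, z' i = α i t * z i := by
  classical
  obtain ⟨c, hc, hker, him⟩ := exists_relation_of_generalPosition hn hα
  set i₀ : Fin n := ⟨0, hn⟩
  have hfib : ∀ z z', modelMap c i₀ z' = modelMap c i₀ z ↔ ∃ t, ∀ i, z' i = α i t * z i := by
    intro z z'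
    constructor
    · intro h
      obtain ⟨u, hu, huz⟩ := exists_circle_mul_of_modelMap_eq hc h
      obtain ⟨t, ht⟩ := him u hu
      exact ⟨t, fun i => by rw [huz, ht]⟩
    · rintro ⟨t, ht⟩
      exact modelMap_eq_of_circle_mul (hker t) ht
  have hquot : IsQuotientMap (modelMap c i₀) :=
    (isClosedMap_modelMap c i₀).isQuotientMap (continuous_modelMap c i₀)
      (surjective_modelMap (hc i₀))
  -- The saturation of an open set is a union of its preimages under torus elements.
  have hopen : IsOpenMap (modelMap c i₀) := by
    intro O hO
    rw [← hquot.isOpen_preimage]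
    have : modelMap c i₀ ⁻¹' (modelMap c i₀ '' O) =
        ⋃ t, (fun z : Fin n → ℂ => fun i => (α i t : ℂ) * z i) ⁻¹' O := by
      ext z
      simp only [Set.mem_preimage, Set.mem_image, Set.mem_iUnion]
      constructor
      · rintro ⟨z', hz', h⟩
        obtain ⟨t, ht⟩ := (hfib _ _).1 h
        exact ⟨t, by rwa [← funext ht]⟩
      · rintro ⟨t, ht⟩
        exact ⟨_, ht, (hfib _ _).2 ⟨t, fun i => rfl⟩⟩
    rw [this]
    refine isOpen_iUnion fun t => hO.preimage ?_
    exact continuous_pi fun i => continuous_const.mul (continuous_apply i)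
  have hrank : Module.finrank ℝ (({i : Fin n // i ≠ i₀} → ℝ) × ℂ) =
      Module.finrank ℝ (EuclideanSpace ℝ (Fin (n + 1))) := by
    simp [Module.finrank_prod, Complex.finrank_real_complex, Fintype.card_subtype_compl]
    omega
  let e := ContinuousLinearEquiv.ofFinrankEq hrank
  refine ⟨e ∘ modelMap c i₀, e.continuous.comp (continuous_modelMap c i₀),
    e.toHomeomorph.isOpenMap.comp hopen, fun z z' => ?_⟩
  rw [← hfib]
  exact e.injective.eq_iff

end LinearModel

/-! ### Smooth torus actions in coordinates -/

section SmoothAction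

open Filter Topology

theorem contMDiff_torusExp (k : ℕ) :
    ContMDiff 𝓘(ℝ, Fin k → ℝ) (torusModel k) ∞ (torusExp : (Fin k → ℝ) → Torus k) := by
  intro v
  rw [contMDiffAt_iff]
  refine ⟨continuous_torusExp.continuousAt, ?_⟩
  have h : ∀ i : Fin k, ContDiffAt ℝ ∞
      (fun w : Fin k → ℝ => extChartAt (𝓡 1) (torusExp v i) (Circle.exp (w i))) v := by
    intro i
    have h1 : ContMDiffAt 𝓘(ℝ, ℝ) (𝓡 1) ∞ Circle.exp (v i) := contMDiff_circleExp.contMDiffAt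
    have h2 := (contMDiffAt_extChartAt (I := 𝓡 1) (n := ∞) (x := torusExp v i)).comp (v i) h1
    have h3 : ContDiffAt ℝ ∞ (fun w : Fin k → ℝ => w i) v := by fun_prop
    exact ContDiffAt.comp (f := fun w : Fin k → ℝ => w i) v (contMDiffAt_iff_contDiffAt.1 h2) h3
  have h3 : ContDiffAt ℝ ∞ (fun (w : Fin k → ℝ) (i : Fin k) =>
      extChartAt (𝓡 1) (torusExp v i) (Circle.exp (w i))) v := contDiffAt_pi.2 h
  exact h3.contDiffWithinAt

variable {k d : ℕ} {X : Type*} [TopologicalSpace X]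
  [ChartedSpace (EuclideanSpace ℝ (Fin d)) X]

section

variable [MulAction (Torus k) X]

theorem continuousOn_smul_extChartAt_symm [ContinuousSMul (Torus k) X] (x : X) :
    ContinuousOn (fun p : Torus k × EuclideanSpace ℝ (Fin d) =>
      p.1 • (extChartAt (𝓡 d) x).symm p.2) {p | p.2 ∈ (extChartAt (𝓡 d) x).target} :=
  continuousOn_fst.smul ((continuousOn_extChartAt_symm x).comp continuousOn_snd fun _ h => h)

/-- The points `(t, v)` such that `t` maps the point with coordinate `v` into `O`. -/
def smulChartDomain (k d : ℕ) {X : Type*} [TopologicalSpace X]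
    [ChartedSpace (EuclideanSpace ℝ (Fin d)) X] [MulAction (Torus k) X] (x : X) (O : Set X) :
    Set (Torus k × EuclideanSpace ℝ (Fin d)) :=
  {p | p.2 ∈ (extChartAt (𝓡 d) x).target ∧ p.1 • (extChartAt (𝓡 d) x).symm p.2 ∈ O}

theorem isOpen_smulChartDomain [ContinuousSMul (Torus k) X] (x : X) {O : Set X} (hO : IsOpen O) :
    IsOpen (smulChartDomain k d x O) := by
  have h : IsOpen {p : Torus k × EuclideanSpace ℝ (Fin d) | p.2 ∈ (extChartAt (𝓡 d) x).target} :=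
    (isOpen_extChartAt_target x).preimage continuous_snd
  exact (continuousOn_smul_extChartAt_symm x).isOpen_inter_preimage h hO

variable [ContMDiffSMul (torusModel k) (𝓡 d) ∞ (Torus k) X]

theorem contMDiff_torusExp_smul :
    ContMDiff (𝓘(ℝ, Fin k → ℝ).prod (𝓡 d)) (𝓡 d) ∞
      (fun p : (Fin k → ℝ) × X => torusExp p.1 • p.2) :=
  ContMDiff.smul (I := torusModel k) ((contMDiff_torusExp k).comp contMDiff_fst) contMDiff_snd

variable [IsManifold (𝓡 d) ∞ X]
  {W : Type*} [NormedAddCommGroup W] [NormedSpace ℝ W]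

theorem contDiffOn_torusExp_smul (x : X) {O : Set X} {F : X → W}
    (hF : ContMDiffOn (𝓡 d) 𝓘(ℝ, W) 1 F O) :
    ContDiffOn ℝ 1 (fun p : (Fin k → ℝ) × EuclideanSpace ℝ (Fin d) =>
      F (torusExp p.1 • (extChartAt (𝓡 d) x).symm p.2))
      (Prod.map torusExp id ⁻¹' smulChartDomain k d x O) := by
  rw [← contMDiffOn_iff_contDiffOn]
  refine hF.comp (t := O) ?_ fun p hp => hp.2
  have h1 : ContMDiffOn 𝓘(ℝ, (Fin k → ℝ) × EuclideanSpace ℝ (Fin d)) 𝓘(ℝ, Fin k → ℝ) 1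
      Prod.fst (Prod.map torusExp id ⁻¹' smulChartDomain k d x O) :=
    contMDiffOn_iff_contDiffOn.2 contDiff_fst.contDiffOn
  have h2 : ContMDiffOn 𝓘(ℝ, (Fin k → ℝ) × EuclideanSpace ℝ (Fin d))
      𝓘(ℝ, EuclideanSpace ℝ (Fin d)) 1
      Prod.snd (Prod.map torusExp id ⁻¹' smulChartDomain k d x O) :=
    contMDiffOn_iff_contDiffOn.2 contDiff_snd.contDiffOn
  have h3 : ContMDiffOn 𝓘(ℝ, (Fin k → ℝ) × EuclideanSpace ℝ (Fin d)) (𝓡 d) 1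
      (fun p => (extChartAt (𝓡 d) x).symm p.2)
      (Prod.map torusExp id ⁻¹' smulChartDomain k d x O) :=
    ((contMDiffOn_extChartAt_symm (n := ∞) x).of_le (by norm_num)).comp h2 fun p hp => hp.1
  exact ((contMDiff_torusExp_smul (k := k) (d := d) (X := X)).of_le
    (by norm_num : (1 : WithTop ℕ∞) ≤ ∞)).comp_contMDiffOn (h1.prodMk h3)

variable [ContinuousSMul (Torus k) X]

/-- The partial derivative of `(t, v) ↦ F (t • v)` in the direction of the manifold. -/
noncomputable def smulDeriv (k : ℕ) {d : ℕ} {X : Type*} [TopologicalSpace X]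
    [ChartedSpace (EuclideanSpace ℝ (Fin d)) X] [MulAction (Torus k) X]
    {W : Type*} [NormedAddCommGroup W] [NormedSpace ℝ W] (x : X) (F : X → W)
    (p : Torus k × EuclideanSpace ℝ (Fin d)) : EuclideanSpace ℝ (Fin d) →L[ℝ] W :=
  fderiv ℝ (fun v => F (p.1 • (extChartAt (𝓡 d) x).symm v)) p.2

theorem hasFDerivAt_smul_and_eq (x : X) {O : Set X} (hO : IsOpen O) {F : X → W}
    (hF : ContMDiffOn (𝓡 d) 𝓘(ℝ, W) 1 F O) {ξ : Fin k → ℝ} {v : EuclideanSpace ℝ (Fin d)}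
    (hp : (torusExp ξ, v) ∈ smulChartDomain k d x O) :
    HasFDerivAt (fun v => F (torusExp ξ • (extChartAt (𝓡 d) x).symm v))
      ((fderiv ℝ (fun p : (Fin k → ℝ) × EuclideanSpace ℝ (Fin d) =>
        F (torusExp p.1 • (extChartAt (𝓡 d) x).symm p.2)) (ξ, v)).comp
          (ContinuousLinearMap.inr ℝ _ _)) v := by
  have hopen : IsOpen (Prod.map torusExp id ⁻¹' smulChartDomain k d x O) :=
    (isOpen_smulChartDomain x hO).preimage (continuous_torusExp.prodMap continuous_id)
  have h1 : HasFDerivAt _ _ (ξ, v) :=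
    ((contDiffOn_torusExp_smul x hF).contDiffAt
      (hopen.mem_nhds (x := (ξ, v)) hp)).differentiableAt (by norm_num) |>.hasFDerivAt
  exact h1.comp v (hasFDerivAt_prodMk_right ξ v)

theorem hasFDerivAt_smulDeriv (x : X) {O : Set X} (hO : IsOpen O) {F : X → W}
    (hF : ContMDiffOn (𝓡 d) 𝓘(ℝ, W) 1 F O) {p : Torus k × EuclideanSpace ℝ (Fin d)}
    (hp : p ∈ smulChartDomain k d x O) :
    HasFDerivAt (fun v => F (p.1 • (extChartAt (𝓡 d) x).symm v)) (smulDeriv k x F p) p.2 := by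
  obtain ⟨t, v⟩ := p
  obtain ⟨ξ, rfl⟩ := torusExp_surjective t
  exact (hasFDerivAt_smul_and_eq x hO hF hp).differentiableAt.hasFDerivAt

/-- Continuity may be tested after pulling back along the open quotient map `torusExp × id`, where
`smulDeriv` is a partial derivative of a `C¹` map between vector spaces. -/
theorem continuousOn_smulDeriv (x : X) {O : Set X} (hO : IsOpen O) {F : X → W}
    (hF : ContMDiffOn (𝓡 d) 𝓘(ℝ, W) 1 F O) :
    ContinuousOn (smulDeriv k x F) (smulChartDomain k d x O) := by
  rintro ⟨t, v⟩ hp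
  obtain ⟨ξ, rfl⟩ := torusExp_surjective t
  refine ContinuousAt.continuousWithinAt ?_
  have hq : IsOpenQuotientMap (Prod.map torusExp id :
      (Fin k → ℝ) × EuclideanSpace ℝ (Fin d) → Torus k × EuclideanSpace ℝ (Fin d)) :=
    isOpenQuotientMap_torusExp.prodMap IsOpenQuotientMap.id
  have hopen : IsOpen (Prod.map torusExp id ⁻¹' smulChartDomain k d x O) :=
    (isOpen_smulChartDomain x hO).preimage (continuous_torusExp.prodMap continuous_id)
  have hnhds := hopen.mem_nhds (x := (ξ, v)) hp
  refine (hq.continuousAt_comp_iff (x := (ξ, v))).1 ?_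
  have h1 : ContinuousAt (fun q => (fderiv ℝ (fun p : (Fin k → ℝ) × EuclideanSpace ℝ (Fin d) =>
        F (torusExp p.1 • (extChartAt (𝓡 d) x).symm p.2)) q).comp
          (ContinuousLinearMap.inr ℝ _ _)) (ξ, v) :=
    (((contDiffOn_torusExp_smul x hF).continuousOn_fderiv_of_isOpen hopen
      le_rfl).continuousAt hnhds).clm_comp continuousAt_const
  refine h1.congr ?_
  filter_upwards [hnhds] with q hq'
  exact (hasFDerivAt_smul_and_eq x hO hF hq').unique (hasFDerivAt_smulDeriv x hO hF hq')

end

/-! ### Differentiation under an integral over a compact space -/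

section ParametricIntegral

open MeasureTheory

variable {K : Type*} [TopologicalSpace K] [CompactSpace K] [SecondCountableTopology K]
  [MeasurableSpace K] [OpensMeasurableSpace K] {μ : Measure K} [IsFiniteMeasure μ]
  {E W : Type*} [NormedAddCommGroup E] [NormedSpace ℝ E] [NormedAddCommGroup W] [NormedSpace ℝ W]

theorem hasFDerivAt_integral_of_compactSpace {Q : E → K → W} {Q' : E → K → E →L[ℝ] W}
    {Ω : Set E} (hΩ : IsOpen Ω)
    (hQ : ∀ v ∈ Ω, ∀ t, HasFDerivAt (fun v => Q v t) (Q' v t) v)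
    (hQc : ∀ v ∈ Ω, Continuous (Q v))
    (hQ'c : ContinuousOn (Function.uncurry Q') (Ω ×ˢ Set.univ)) {v : E} (hv : v ∈ Ω) :
    HasFDerivAt (fun v => ∫ t, Q v t ∂μ) (∫ t, Q' v t ∂μ) v := by
  have hcont : ∀ w ∈ Ω, Continuous (Q' w) := fun w hw =>
    hQ'c.comp_continuous (f := fun t => (w, t)) (by fun_prop) fun t => ⟨hw, trivial⟩
  obtain ⟨C, hC⟩ : ∃ C, ∀ t, ‖Q' v t‖ < C := by
    obtain ⟨C, hC⟩ := isCompact_univ.exists_bound_of_continuousOn (hcont v hv).continuousOn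
    exact ⟨C + 1, fun t => (hC t trivial).trans_lt (lt_add_one C)⟩
  -- Compactness of `K` makes the bound uniform in `t`, so a constant dominates.
  have hev : ∀ᶠ w in 𝓝 v, ∀ t ∈ (Set.univ : Set K), ‖Q' w t‖ < C := by
    refine isCompact_univ.eventually_forall_of_forall_eventually fun t _ => ?_
    have h1 : ContinuousAt (Function.uncurry Q') (v, t) :=
      hQ'c.continuousAt ((hΩ.prod isOpen_univ).mem_nhds ⟨hv, trivial⟩)
    exact h1.norm.eventually_lt continuousAt_const (hC t)
  refine hasFDerivAt_integral_of_dominated_of_fderiv_le (s := Ω ∩ {w | ∀ t, ‖Q' w t‖ < C})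
    (bound := fun _ => C) ?_ ?_ ?_ ?_ ?_ ?_ ?_
  · exact Filter.inter_mem (hΩ.mem_nhds hv) (hev.mono fun w hw t => hw t trivial)
  · filter_upwards [hΩ.mem_nhds hv] with w hw
    exact (hQc w hw).aestronglyMeasurable
  · exact (hQc v hv).integrable_of_hasCompactSupport (HasCompactSupport.of_compactSpace _)
  · exact (hcont v hv).aestronglyMeasurable
  · exact Eventually.of_forall fun t w hw => (hw.2 t).le
  · exact integrable_const C
  · exact Eventually.of_forall fun t w hw => hQ w hw.1 t

theorem contDiffOn_integral_of_compactSpace {Q : E → K → W} {Q' : E → K → E →L[ℝ] W}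
    {Ω : Set E} (hΩ : IsOpen Ω)
    (hQ : ∀ v ∈ Ω, ∀ t, HasFDerivAt (fun v => Q v t) (Q' v t) v)
    (hQc : ∀ v ∈ Ω, Continuous (Q v))
    (hQ'c : ContinuousOn (Function.uncurry Q') (Ω ×ˢ Set.univ)) :
    ContDiffOn ℝ 1 (fun v => ∫ t, Q v t ∂μ) Ω := by
  have hd : ∀ v ∈ Ω, HasFDerivAt (fun v => ∫ t, Q v t ∂μ) (∫ t, Q' v t ∂μ) v := fun v hv =>
    hasFDerivAt_integral_of_compactSpace hΩ hQ hQc hQ'c hv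
  have hc : ContinuousOn (fun v => ∫ t, Q' v t ∂μ) Ω :=
    continuousOn_integral_of_compact_support isCompact_univ hQ'c
      fun p x _ hx => absurd (Set.mem_univ x) hx
  rw [← zero_add (1 : WithTop ℕ∞), contDiffOn_succ_iff_fderiv_of_isOpen hΩ]
  refine ⟨fun v hv => (hd v hv).differentiableAt.differentiableWithinAt, by simp, ?_⟩
  exact contDiffOn_zero.2 (hc.congr fun v hv => (hd v hv).fderiv)

end ParametricIntegral

/-! ### Local diffeomorphisms and the inverse function theorem -/

section LocalDiffeomorphism

variable {E W : Type*} [NormedAddCommGroup E] [NormedSpace ℝ E] [NormedAddCommGroup W]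
  [NormedSpace ℝ W]

theorem IsLocalDiffeomorphAt.of_openPartialHomeomorph {f : X → W} {x : X}
    (e : OpenPartialHomeomorph X W) (hx : x ∈ e.source)
    (he : ContMDiffOn (𝓡 d) 𝓘(ℝ, W) 1 e e.source)
    (he' : ContMDiffOn 𝓘(ℝ, W) (𝓡 d) 1 e.symm e.target) (hf : Set.EqOn f e e.source) :
    IsLocalDiffeomorphAt (𝓡 d) 𝓘(ℝ, W) 1 f x :=
  ⟨{ toPartialEquiv := e.toPartialEquiv
     open_source := e.open_source
     open_target := e.open_target
     contMDiffOn_toFun := he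
     contMDiffOn_invFun := he' }, hx, hf⟩

theorem IsLocalDiffeomorphAt.exists_openPartialHomeomorph {f : X → W} {x : X}
    (hf : IsLocalDiffeomorphAt (𝓡 d) 𝓘(ℝ, W) 1 f x) :
    ∃ e : OpenPartialHomeomorph X W, x ∈ e.source ∧
      ContMDiffOn (𝓡 d) 𝓘(ℝ, W) 1 e e.source ∧
      ContMDiffOn 𝓘(ℝ, W) (𝓡 d) 1 e.symm e.target ∧ Set.EqOn f e e.source := by
  obtain ⟨Φ, hx, h⟩ := hf
  exact ⟨Φ.toOpenPartialHomeomorph, hx, Φ.contMDiffOn_toFun, Φ.contMDiffOn_invFun, h⟩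

theorem IsLocalDiffeomorphAt.eventually {f : X → W} {x : X}
    (hf : IsLocalDiffeomorphAt (𝓡 d) 𝓘(ℝ, W) 1 f x) :
    ∀ᶠ y in 𝓝 x, IsLocalDiffeomorphAt (𝓡 d) 𝓘(ℝ, W) 1 f y := by
  obtain ⟨e, hx, he, he', hfe⟩ := hf.exists_openPartialHomeomorph
  filter_upwards [e.open_source.mem_nhds hx] with y hy
  exact .of_openPartialHomeomorph e hy he he' hfe

/-- The inverse function theorem on a manifold, in the preferred chart. -/
theorem IsLocalDiffeomorphAt.of_hasFDerivAt [IsManifold (𝓡 d) ∞ X] [CompleteSpace W]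
    {f : X → W} {x : X}
    (hf : ContDiffAt ℝ 1 (f ∘ (extChartAt (𝓡 d) x).symm) (extChartAt (𝓡 d) x x))
    (f' : EuclideanSpace ℝ (Fin d) ≃L[ℝ] W)
    (hf' : HasFDerivAt (f ∘ (extChartAt (𝓡 d) x).symm)
      (f' : EuclideanSpace ℝ (Fin d) →L[ℝ] W) (extChartAt (𝓡 d) x x)) :
    IsLocalDiffeomorphAt (𝓡 d) 𝓘(ℝ, W) 1 f x := by
  set a := extChartAt (𝓡 d) x x with ha
  set g := f ∘ (extChartAt (𝓡 d) x).symm with hg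
  set e₀ := hf.toOpenPartialHomeomorph g hf' one_ne_zero with he₀
  have he₀c : (e₀ : EuclideanSpace ℝ (Fin d) → W) = g :=
    hf.toOpenPartialHomeomorph_coe hf' one_ne_zero
  -- Restricting to where the derivative stays invertible makes the inverse `C¹` on its whole
  -- domain, not only at the image of `x`.
  have hinv : ∀ᶠ v in 𝓝 a, ContDiffAt ℝ 1 g v ∧
      fderiv ℝ g v ∈ Set.range ((↑) : (EuclideanSpace ℝ (Fin d) ≃L[ℝ] W) → _) := by
    have h1 : ∀ᶠ v in 𝓝 a, ContDiffAt ℝ 1 g v := hf.eventually (by simp)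
    have h2 : ContinuousAt (fderiv ℝ g) a := (hf.fderiv_right (m := 0) (by simp)).continuousAt
    have h3 : ∀ᶠ v in 𝓝 a,
        fderiv ℝ g v ∈ Set.range ((↑) : (EuclideanSpace ℝ (Fin d) ≃L[ℝ] W) → _) := by
      apply h2.eventually
      rw [hf'.fderiv]
      exact f'.nhds
    exact h1.and h3
  obtain ⟨U, hU, hUo, haU⟩ := mem_nhds_iff.1 hinv
  set e₁ := e₀.restrOpen U hUo with he₁
  have he₁c : (e₁ : EuclideanSpace ℝ (Fin d) → W) = g := he₀c
  have he₁U : e₁.source ⊆ U := fun v hv => by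
    simp only [he₁, OpenPartialHomeomorph.restrOpen_source] at hv; exact hv.2
  set c : OpenPartialHomeomorph X (EuclideanSpace ℝ (Fin d)) :=
    chartAt (EuclideanSpace ℝ (Fin d)) x with hc
  have hcc : ∀ y, extChartAt (𝓡 d) x y = c y := fun y => rfl
  have hcs : ∀ y, (extChartAt (𝓡 d) x).symm y = c.symm y := fun y => rfl
  have hcm : ContMDiffOn (𝓡 d) 𝓘(ℝ, EuclideanSpace ℝ (Fin d)) 1 c c.source :=
    (contMDiffOn_extChartAt (I := 𝓡 d) (n := ∞) (x := x)).of_le (by norm_num)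
  have hcsm : ContMDiffOn 𝓘(ℝ, EuclideanSpace ℝ (Fin d)) (𝓡 d) 1 c.symm c.target := by
    have h := (contMDiffOn_extChartAt_symm (I := 𝓡 d) (n := ∞) x).of_le
      (by norm_num : (1 : WithTop ℕ∞) ≤ ∞)
    refine h.mono fun v hv => ?_
    simpa [extChartAt_target] using hv
  have ha₁ : a ∈ e₁.source := by
    simp only [he₁, OpenPartialHomeomorph.restrOpen_source]
    exact ⟨hf.mem_toOpenPartialHomeomorph_source hf' one_ne_zero, haU⟩
  refine .of_openPartialHomeomorph (c.trans e₁) ?_ ?_ ?_ ?_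
  · rw [OpenPartialHomeomorph.trans_source]
    exact ⟨mem_chart_source _ x, ha₁⟩
  · rw [OpenPartialHomeomorph.coe_trans, he₁c]
    have hg1 : ContMDiffOn 𝓘(ℝ, EuclideanSpace ℝ (Fin d)) 𝓘(ℝ, W) 1 g e₁.source :=
      contMDiffOn_iff_contDiffOn.2 fun v hv => (hU (he₁U hv)).1.contDiffWithinAt
    refine hg1.comp (hcm.mono ?_) ?_
    · exact fun y hy => hy.1
    · exact fun y hy => hy.2
  · have hs : ContMDiffOn 𝓘(ℝ, W) 𝓘(ℝ, EuclideanSpace ℝ (Fin d)) 1 e₁.symm e₁.target := by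
      refine contMDiffOn_iff_contDiffOn.2 fun w hw => ContDiffAt.contDiffWithinAt ?_
      have hw' := he₁U (e₁.map_target hw)
      obtain ⟨L, hL⟩ := (hU hw').2
      refine e₁.contDiffAt_symm (f₀' := L) hw ?_ ?_
      · rw [he₁c, hL]
        exact ((hU hw').1.differentiableAt one_ne_zero).hasFDerivAt
      · rw [he₁c]; exact (hU hw').1
    refine hcsm.comp (hs.mono ?_) ?_
    · exact fun y hy => hy.1
    · exact fun y hy => hy.2
  · intro y hy
    rw [OpenPartialHomeomorph.coe_trans, he₁c]
    simp only [hg, Function.comp_apply, hcs]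
    rw [c.left_inv hy.1]

end LocalDiffeomorphism

end SmoothAction

/-! ### Linearization at a point of the action of its stabilizer -/

section Linearization

open Filter Topology MeasureTheory

variable {k d : ℕ} {X : Type*} [TopologicalSpace X]
  [ChartedSpace (EuclideanSpace ℝ (Fin d)) X] [MulAction (Torus k) X]

theorem mem_smulChartDomain_self {x : X} {t : Torus k} (ht : t • x = x) :
    (t, extChartAt (𝓡 d) x x) ∈
      smulChartDomain k d x (chartAt (EuclideanSpace ℝ (Fin d)) x).source :=
  ⟨mem_extChartAt_target x, by
    rw [extChartAt_to_inv, ht]; exact mem_chart_source _ x⟩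

variable [IsManifold (𝓡 d) ∞ X]
  [ContMDiffSMul (torusModel k) (𝓡 d) ∞ (Torus k) X] [ContinuousSMul (Torus k) X]

/-- The derivative at `x`, in the preferred chart at `x`, of the action of `t`. -/
noncomputable def isotropyRep (d : ℕ) {k : ℕ} {X : Type*} [TopologicalSpace X]
    [ChartedSpace (EuclideanSpace ℝ (Fin d)) X] [MulAction (Torus k) X] (x : X) (t : Torus k) :
    EuclideanSpace ℝ (Fin d) →L[ℝ] EuclideanSpace ℝ (Fin d) :=
  smulDeriv k x (extChartAt (𝓡 d) x) (t, extChartAt (𝓡 d) x x)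

theorem contMDiffOn_extChartAt_one (x : X) :
    ContMDiffOn (𝓡 d) 𝓘(ℝ, EuclideanSpace ℝ (Fin d)) 1 (extChartAt (𝓡 d) x)
      (chartAt (EuclideanSpace ℝ (Fin d)) x).source :=
  (contMDiffOn_extChartAt (I := 𝓡 d) (n := ∞) (x := x)).of_le (by norm_num)

theorem hasFDerivAt_isotropyRep {x : X} {t : Torus k} (ht : t • x = x) :
    HasFDerivAt (fun v => extChartAt (𝓡 d) x (t • (extChartAt (𝓡 d) x).symm v))
      (isotropyRep d x t) (extChartAt (𝓡 d) x x) :=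
  hasFDerivAt_smulDeriv x (chartAt _ x).open_source (contMDiffOn_extChartAt_one x)
    (mem_smulChartDomain_self ht)

theorem isotropyRep_one (x : X) : isotropyRep d x (1 : Torus k) = ContinuousLinearMap.id ℝ _ := by
  refine (hasFDerivAt_isotropyRep (one_smul _ x)).unique
    ((hasFDerivAt_id _).congr_of_eventuallyEq ?_)
  filter_upwards [extChartAt_target_mem_nhds (I := 𝓡 d) x] with v hv
  rw [one_smul, (extChartAt (𝓡 d) x).right_inv hv, id]

theorem isotropyRep_mul {x : X} {s t : Torus k} (hs : s • x = x) (ht : t • x = x) :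
    isotropyRep d x (s * t) = (isotropyRep d x s).comp (isotropyRep d x t) := by
  have hst : (s * t) • x = x := by rw [mul_smul, ht, hs]
  have h1 : extChartAt (𝓡 d) x (t • (extChartAt (𝓡 d) x).symm (extChartAt (𝓡 d) x x)) =
      extChartAt (𝓡 d) x x := by rw [extChartAt_to_inv, ht]
  have h2 : HasFDerivAt _ _ (extChartAt (𝓡 d) x x) :=
    HasFDerivAt.comp (extChartAt (𝓡 d) x x)
      (g := fun v => extChartAt (𝓡 d) x (s • (extChartAt (𝓡 d) x).symm v))
      (f := fun v => extChartAt (𝓡 d) x (t • (extChartAt (𝓡 d) x).symm v))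
      (g' := isotropyRep d x s)
      (by rw [h1]; exact hasFDerivAt_isotropyRep hs) (hasFDerivAt_isotropyRep ht)
  refine (hasFDerivAt_isotropyRep hst).unique (h2.congr_of_eventuallyEq ?_)
  have hO := (isOpen_smulChartDomain (d := d) x (chartAt (EuclideanSpace ℝ (Fin d)) x).open_source
    |>.preimage (Continuous.prodMk_right t)).mem_nhds (mem_smulChartDomain_self ht)
  filter_upwards [hO] with v hv
  simp only [Function.comp_apply]
  rw [(extChartAt (𝓡 d) x).left_inv (by rw [extChartAt_source]; exact hv.2), mul_smul]

/-- Bochner's averaging: `f z = ∫ D(h⁻¹) φ(h z) dh` over Haar measure of the compact group `H`, with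
`φ` a chart at `x` and `D` the isotropy representation. Invariance of the measure makes `f`
equivariant, and its derivative at `x` is the identity in the chart. -/
theorem isLocalDiffeomorphAt_extChartAt_linearization [T2Space X] {H : Subgroup (Torus k)}
    (hH : IsClosed (H : Set (Torus k))) {x : X} (hx : ∀ h ∈ H, h • x = x) :
    ∃ f : X → EuclideanSpace ℝ (Fin d),
      IsLocalDiffeomorphAt (𝓡 d) 𝓘(ℝ, EuclideanSpace ℝ (Fin d)) 1 f x ∧
      ∀ᶠ z in 𝓝 x, ∀ h ∈ H, f (h • z) = isotropyRep d x h (f z) := by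
  have hHc : CompactSpace H := isCompact_iff_compactSpace.1 hH.isCompact
  let _ : MeasurableSpace H := borel H
  have _ : BorelSpace H := ⟨rfl⟩
  set μ : Measure H := Measure.haarMeasure ⊤ with hμ
  have hμ1 : μ Set.univ = 1 := by
    have := Measure.haarMeasure_self (K₀ := (⊤ : TopologicalSpace.PositiveCompacts H))
    simpa using this
  have _ : IsProbabilityMeasure μ := ⟨hμ1⟩
  set φ := extChartAt (𝓡 d) x with hφ
  set a := φ x with ha
  set D := isotropyRep d (k := k) x with hD
  set O := (chartAt (EuclideanSpace ℝ (Fin d)) x).source with hO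
  have hOo : IsOpen O := (chartAt (EuclideanSpace ℝ (Fin d)) x).open_source
  have hdom : IsOpen (smulChartDomain k d x O) := isOpen_smulChartDomain x hOo
  -- Coordinates of points whose entire `H`-orbit stays in the chart; open because `H` is compact.
  set Ω : Set (EuclideanSpace ℝ (Fin d)) := {v | ∀ h : H, ((h : Torus k), v) ∈
    smulChartDomain k d x O} with hΩ
  have hΩo : IsOpen Ω := by
    rw [isOpen_iff_eventually]
    intro v hv
    have := isCompact_univ.eventually_forall_of_forall_eventually (x₀ := v) (K := Set.univ)
      (P := fun v (h : H) => ((h : Torus k), v) ∈ smulChartDomain k d x O) fun h _ => by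
        have hc : Continuous fun p : EuclideanSpace ℝ (Fin d) × H => ((p.2 : Torus k), p.1) := by
          fun_prop
        exact (hdom.preimage hc).mem_nhds (hv h)
    exact this.mono fun w hw h => hw h trivial
  have haΩ : a ∈ Ω := fun h => mem_smulChartDomain_self (hx h h.2)
  have hDc : Continuous fun h : H => D (h : Torus k) :=
    (continuousOn_smulDeriv x hOo (contMDiffOn_extChartAt_one x)).comp_continuous
      (f := fun h : H => ((h : Torus k), a)) (by fun_prop) fun h => haΩ h
  have hDinv : Continuous fun h : H => D ((h : Torus k)⁻¹) := hDc.comp continuous_inv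
  have hφc : ∀ v ∈ Ω, Continuous fun h : H => φ ((h : Torus k) • φ.symm v) := by
    intro v hv
    have h1 : ContinuousOn φ O := by
      rw [hO, ← extChartAt_source (𝓡 d) x]; exact continuousOn_extChartAt x
    exact h1.comp_continuous (f := fun h : H => (h : Torus k) • φ.symm v)
      (continuous_subtype_val.smul continuous_const) fun h => (hv h).2
  set f : X → EuclideanSpace ℝ (Fin d) := fun z => ∫ h : H, D ((h : Torus k)⁻¹) (φ ((h : Torus k) • z)) ∂μ with hf
  have hQ : ∀ v ∈ Ω, ∀ h : H,
      HasFDerivAt (fun v => D ((h : Torus k)⁻¹) (φ ((h : Torus k) • φ.symm v)))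
      ((D ((h : Torus k)⁻¹)).comp (smulDeriv k x φ ((h : Torus k), v))) v := fun v hv h =>
    (D ((h : Torus k)⁻¹)).hasFDerivAt.comp v
      (hasFDerivAt_smulDeriv x hOo (contMDiffOn_extChartAt_one x) (hv h))
  have hQc : ∀ v ∈ Ω, Continuous fun h : H => D ((h : Torus k)⁻¹) (φ ((h : Torus k) • φ.symm v)) :=
    fun v hv => hDinv.clm_apply (hφc v hv)
  have hQ'c : ContinuousOn (Function.uncurry fun (v : EuclideanSpace ℝ (Fin d)) (h : H) =>
      (D ((h : Torus k)⁻¹)).comp (smulDeriv k x φ ((h : Torus k), v))) (Ω ×ˢ Set.univ) := by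
    refine ContinuousOn.clm_comp (hDinv.comp continuous_snd).continuousOn ?_
    exact (continuousOn_smulDeriv x hOo (contMDiffOn_extChartAt_one x)).comp
      (f := fun p : EuclideanSpace ℝ (Fin d) × H => ((p.2 : Torus k), p.1))
      (by fun_prop) fun p hp => hp.1 p.2
  have hderiv := hasFDerivAt_integral_of_compactSpace (μ := μ) hΩo hQ hQc hQ'c haΩ
  have hcd := contDiffOn_integral_of_compactSpace (μ := μ) hΩo hQ hQc hQ'c
  have hid : ∫ h : H, (D ((h : Torus k)⁻¹)).comp (smulDeriv k x φ ((h : Torus k), a)) ∂μ =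
      ((ContinuousLinearEquiv.refl ℝ (EuclideanSpace ℝ (Fin d)) :
        EuclideanSpace ℝ (Fin d) ≃L[ℝ] EuclideanSpace ℝ (Fin d)) :
        EuclideanSpace ℝ (Fin d) →L[ℝ] EuclideanSpace ℝ (Fin d)) := by
    have h1 : ∀ h : H, (D ((h : Torus k)⁻¹)).comp (smulDeriv k x φ ((h : Torus k), a)) =
        ContinuousLinearMap.id ℝ _ := by
      intro h
      have h2 := isotropyRep_mul (d := d) (hx _ (H.inv_mem h.2)) (hx _ h.2)
      rw [inv_mul_cancel, isotropyRep_one] at h2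
      exact h2.symm
    simp only [h1, integral_const, measureReal_def, hμ1]
    simp
  rw [hid] at hderiv
  refine ⟨f, .of_hasFDerivAt (hcd.contDiffAt (hΩo.mem_nhds haΩ)) _ hderiv, ?_⟩
  have hΩx : ∀ᶠ z in 𝓝 x, z ∈ O ∧ φ z ∈ Ω :=
    (hOo.eventually_mem (mem_chart_source _ x)).and
      ((continuousAt_extChartAt x).eventually (hΩo.mem_nhds haΩ))
  filter_upwards [hΩx] with z hz g hg
  obtain ⟨hzO, hzΩ⟩ := hz
  have hzφ : φ.symm (φ z) = z := φ.left_inv (by rw [hφ, extChartAt_source]; exact hzO)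
  have hint := hQc _ hzΩ
  rw [hzφ] at hint
  have hG : ∀ h : H, D (((⟨g, hg⟩ * h : H) : Torus k)⁻¹ * g) (φ (((⟨g, hg⟩ * h : H) : Torus k) • z))
      = D ((h : Torus k)⁻¹) (φ ((h : Torus k) • g • z)) := by
    intro h
    congr 2
    · simp
    · rw [smul_smul, Subgroup.coe_mul, mul_comm]
  simp only [hf]
  rw [← (D g).integral_comp_comm (hint.integrable_of_hasCompactSupport
    (HasCompactSupport.of_compactSpace _))]
  simp only [← hG]
  rw [integral_mul_left_eq_self (μ := μ)
    (fun h : H => D ((h : Torus k)⁻¹ * g) (φ ((h : Torus k) • z))) ⟨g, hg⟩]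
  refine integral_congr_ae (Eventually.of_forall fun h => ?_)
  simp only
  rw [mul_comm, hD, isotropyRep_mul (hx _ hg) (hx _ (H.inv_mem h.2))]
  rfl

theorem tangentRep_eq_isotropyRep {x : X} {t : Torus k} (ht : t • x = x)
    (v : TangentSpace (𝓡 d) x) : tangentRep (d := d) x t v = isotropyRep d x t v := by
  have h1 : MDifferentiableAt (𝓡 d) (𝓡 d) (fun y : X => t • y) x :=
    (ContMDiffSMul.contMDiff_const_smul (I := torusModel k) (I' := 𝓡 d) (n := ∞) t
      |>.mdifferentiable (by simp)) x
  have h2 : writtenInExtChartAt (𝓡 d) (𝓡 d) x (fun y : X => t • y) =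
      fun v => extChartAt (𝓡 d) x (t • (extChartAt (𝓡 d) x).symm v) := by
    funext v
    simp only [writtenInExtChartAt, Function.comp_apply, ht]
  have h3 : fderivWithin ℝ (fun v => extChartAt (𝓡 d) x (t • (extChartAt (𝓡 d) x).symm v))
      (Set.range (𝓡 d)) (extChartAt (𝓡 d) x x) = isotropyRep d x t := by
    rw [ModelWithCorners.range_eq_univ, fderivWithin_univ]
    exact (hasFDerivAt_isotropyRep (d := d) ht).fderiv
  unfold tangentRep
  rw [h1.mfderiv, h2]
  exact congrArg (fun A : EuclideanSpace ℝ (Fin d) →L[ℝ] EuclideanSpace ℝ (Fin d) => A v) h3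

/-- Near `x`, the action of the stabilizer of `x` is modelled, through a local diffeomorphism, on
its linear action on `ℂⁿ` with weights `α`. -/
def HasLinearModel (d : ℕ) {k n : ℕ} {X : Type*} [TopologicalSpace X]
    [ChartedSpace (EuclideanSpace ℝ (Fin d)) X] [MulAction (Torus k) X]
    (α : Fin n → (Torus k →ₜ* Circle)) (x : X) : Prop :=
  ∃ f : X → (Fin n → ℂ), IsLocalDiffeomorphAt (𝓡 d) 𝓘(ℝ, Fin n → ℂ) 1 f x ∧
    ∀ᶠ z in 𝓝 x, ∀ h ∈ MulAction.stabilizer (Torus k) x, ∀ i, f (h • z) i = α i h * f z i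

theorem ContinuousLinearEquiv.isLocalDiffeomorphAt {E F : Type*} [NormedAddCommGroup E]
    [NormedSpace ℝ E] [NormedAddCommGroup F] [NormedSpace ℝ F] (L : E ≃L[ℝ] F) (v : E) :
    IsLocalDiffeomorphAt 𝓘(ℝ, E) 𝓘(ℝ, F) 1 L v :=
  ⟨{ toPartialEquiv := L.toEquiv.toPartialEquiv
     open_source := isOpen_univ
     open_target := isOpen_univ
     contMDiffOn_toFun := L.contDiff.contMDiff.contMDiffOn
     contMDiffOn_invFun := L.symm.contDiff.contMDiff.contMDiffOn }, trivial, fun _ _ => rfl⟩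

theorem isClosed_stabilizer [T2Space X] (x : X) :
    IsClosed (MulAction.stabilizer (Torus k) x : Set (Torus k)) :=
  isClosed_eq (f := fun t : Torus k => t • x) (continuous_id.smul continuous_const) continuous_const

theorem hasLinearModel_of_hasWeights [T2Space X] {n : ℕ} {α : Fin n → (Torus k →ₜ* Circle)} {x : X}
    (hx : x ∈ MulAction.fixedPoints (Torus k) X)
    (h : HasWeights (V := TangentSpace (𝓡 d) x) (fun t v => tangentRep x t v) α) :
    HasLinearModel d α x := by
  obtain ⟨L, hL⟩ := h
  obtain ⟨f, hf, hfe⟩ := isLocalDiffeomorphAt_extChartAt_linearization (d := d)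
    (isClosed_stabilizer (k := k) x) fun h hh => hh
  let L' : EuclideanSpace ℝ (Fin d) ≃L[ℝ] (Fin n → ℂ) :=
    LinearEquiv.toContinuousLinearEquiv (L : EuclideanSpace ℝ (Fin d) ≃ₗ[ℝ] (Fin n → ℂ))
  refine ⟨L' ∘ f, hf.comp _ _ (L'.isLocalDiffeomorphAt _), ?_⟩
  filter_upwards [hfe] with z hz h hh i
  have h1 := (congrArg (fun w => L w i) (tangentRep_eq_isotropyRep (hx h) (f z))).symm.trans
    (hL h (f z) i)
  change L' (f (h • z)) i = _
  rw [hz h hh]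
  exact h1

/-- This is the closedness half of the propagation. Linearize at `y` by `f`. Since `z` has the same
stabilizer, `f z` is fixed by the linear action at `y`, so the derivative there of the transition to
the model at `z` intertwines the isotropy representation at `y` with the weights `α`. -/
theorem eventually_hasLinearModel_of_stabilizer_eq [T2Space X] {n : ℕ}
    {α : Fin n → (Torus k →ₜ* Circle)} (y : X) :
    ∀ᶠ z in 𝓝 y, MulAction.stabilizer (Torus k) z = MulAction.stabilizer (Torus k) y →
      HasLinearModel d α z → HasLinearModel d α y := by
  obtain ⟨f, hf, hfe⟩ := isLocalDiffeomorphAt_extChartAt_linearization (d := d)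
    (isClosed_stabilizer (k := k) y) fun h hh => hh
  filter_upwards [hf.eventually, hfe.eventually_nhds] with z hfz hez hst hmod
  obtain ⟨g, hg, hge⟩ := hmod
  rw [hst] at hge
  have hfz' := hfz.localInverse_isLocalDiffeomorphAt
  set r := hfz.localInverse with hr
  have hrz : r (f z) = z := hfz.localInverse_left_inv hfz.localInverse_mem_target
  have hκ : IsLocalDiffeomorphAt 𝓘(ℝ, EuclideanSpace ℝ (Fin d)) 𝓘(ℝ, Fin n → ℂ) 1 (g ∘ r) (f z) :=
    hfz'.comp _ _ (by rw [hrz]; exact hg)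
  obtain ⟨L, hL⟩ : ∃ L : EuclideanSpace ℝ (Fin d) ≃L[ℝ] (Fin n → ℂ),
      HasFDerivAt (g ∘ r) (L : EuclideanSpace ℝ (Fin d) →L[ℝ] (Fin n → ℂ)) (f z) := by
    have h2 := (contMDiffAt_iff_contDiffAt.1 hκ.contMDiffAt).differentiableAt one_ne_zero
    refine ⟨hκ.mfderivToContinuousLinearEquiv one_ne_zero, ?_⟩
    have h3 := h2.hasFDerivAt
    rw [← mfderiv_eq_fderiv] at h3
    exact h3
  refine ⟨L ∘ f, hf.comp _ _ (L.isLocalDiffeomorphAt _), ?_⟩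
  have hLA : ∀ h ∈ MulAction.stabilizer (Torus k) y, ∀ v i,
      L (isotropyRep d y h v) i = α i h * L v i := by
    intro h hh v i
    have hhz : h • z = z := by rw [← hst] at hh; exact hh
    have hAz : isotropyRep d y h (f z) = f z := by rw [← hez.self_of_nhds h hh, hhz]
    have hrc : Tendsto r (𝓝 (f z)) (𝓝 z) := by
      have := hfz'.contMDiffAt.continuousAt
      rw [ContinuousAt, hrz] at this
      exact this
    have hev : ∀ᶠ w in 𝓝 (f z), (g ∘ r) (isotropyRep d y h w) i = α i h * (g ∘ r) w i := by
      have h1 : ∀ᶠ z' in 𝓝 z, r (f z') = z' := hfz.localInverse_eventuallyEq_left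
      have h2 : ∀ᶠ z' in 𝓝 z, r (f (h • z')) = h • z' := by
        have hc : Tendsto (fun z' : X => h • z') (𝓝 z) (𝓝 z) := by
          have := (continuous_const_smul h).continuousAt (x := z)
          rwa [ContinuousAt, hhz] at this
        exact hc.eventually h1
      filter_upwards [hfz.localInverse_eventuallyEq_right, hrc.eventually h2,
        hrc.eventually hez, hrc.eventually hge] with w hw hw2 hw3 hw4
      have hw' : f (r w) = w := hw
      simp only [Function.comp_apply]
      rw [← hw4 h hh i, ← hw2, hw3 h hh, hw']
    have hd1 : HasFDerivAt (fun w => (g ∘ r) (isotropyRep d y h w) i)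
        ((ContinuousLinearMap.proj (R := ℝ) (φ := fun _ : Fin n => ℂ) i).comp
          ((L : EuclideanSpace ℝ (Fin d) →L[ℝ] (Fin n → ℂ)).comp (isotropyRep d y h))) (f z) := by
      refine (ContinuousLinearMap.proj (R := ℝ) (φ := fun _ : Fin n => ℂ) i).hasFDerivAt.comp
        (f z) ?_
      refine HasFDerivAt.comp (f z) (g := g ∘ r) ?_ (isotropyRep d y h).hasFDerivAt
      rw [hAz]; exact hL
    have hd2 : HasFDerivAt (fun w => (α i h : ℂ) * (g ∘ r) w i)
        ((α i h : ℂ) • (ContinuousLinearMap.proj (R := ℝ) (φ := fun _ : Fin n => ℂ) i).comp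
          (L : EuclideanSpace ℝ (Fin d) →L[ℝ] (Fin n → ℂ))) (f z) :=
      ((ContinuousLinearMap.proj (R := ℝ) (φ := fun _ : Fin n => ℂ) i).hasFDerivAt.comp
        (f z) hL).const_mul (α i h : ℂ)
    have := (hd1.congr_of_eventuallyEq (hev.mono fun _ h => h.symm)).unique hd2
    exact congrArg (fun A => A v) this
  filter_upwards [hfe] with z' hz' h hh i
  simp only [Function.comp_apply]
  rw [hz' h hh, hLA h hh]

end Linearization

/-! ### Equivariant functions and the infinitesimal action -/

section EquivariantFunctions

open Filter Topology MeasureTheory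

/-- Both ranges are the quotient by the common kernel; extend their isomorphism by any isomorphism
of complements, which have equal dimension. -/
theorem LinearMap.exists_linearEquiv_comp_eq_of_ker_eq {K U V : Type*} [Field K] [AddCommGroup U]
    [Module K U] [AddCommGroup V] [Module K V] [FiniteDimensional K V] {P Q : U →ₗ[K] V}
    (h : LinearMap.ker P = LinearMap.ker Q) : ∃ A : V ≃ₗ[K] V, ∀ u, A (P u) = Q u := by
  obtain ⟨C₁, hC₁⟩ := Submodule.exists_isCompl (LinearMap.range P)
  obtain ⟨C₂, hC₂⟩ := Submodule.exists_isCompl (LinearMap.range Q)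
  let e : LinearMap.range P ≃ₗ[K] LinearMap.range Q :=
    P.quotKerEquivRange.symm ≪≫ₗ Submodule.quotEquivOfEq _ _ h ≪≫ₗ Q.quotKerEquivRange
  have hfin : Module.finrank K C₁ = Module.finrank K C₂ := by
    have h1 := Submodule.finrank_add_eq_of_isCompl hC₁
    have h2 := Submodule.finrank_add_eq_of_isCompl hC₂
    have h3 := e.finrank_eq
    omega
  let e' : C₁ ≃ₗ[K] C₂ := LinearEquiv.ofFinrankEq _ _ hfin
  refine ⟨(Submodule.prodEquivOfIsCompl _ _ hC₁).symm ≪≫ₗ e.prodCongr e' ≪≫ₗ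
    Submodule.prodEquivOfIsCompl _ _ hC₂, fun u => ?_⟩
  have h1 : (Submodule.prodEquivOfIsCompl _ _ hC₁).symm (P u) =
      ((⟨P u, LinearMap.mem_range_self P u⟩ : LinearMap.range P), 0) :=
    Submodule.prodEquivOfIsCompl_symm_apply_left _ _ hC₁ ⟨P u, LinearMap.mem_range_self P u⟩
  have h2 : e ⟨P u, LinearMap.mem_range_self P u⟩ = ⟨Q u, LinearMap.mem_range_self Q u⟩ := by
    have h3 : P.quotKerEquivRange.symm ⟨P u, LinearMap.mem_range_self P u⟩ =
        Submodule.Quotient.mk u := by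
      rw [LinearEquiv.symm_apply_eq]; rfl
    simp only [e, LinearEquiv.trans_apply, h3]
    rfl
  simp only [LinearEquiv.trans_apply, h1, LinearEquiv.prodCongr_apply, h2, map_zero]
  simp

variable {k d : ℕ} {X : Type*} [TopologicalSpace X]
  [ChartedSpace (EuclideanSpace ℝ (Fin d)) X] [MulAction (Torus k) X]
  [ContMDiffSMul (torusModel k) (𝓡 d) ∞ (Torus k) X] [ContinuousSMul (Torus k) X]

/-- If the derivative of `ξ ↦ f (exp ξ • x)` at `0` kills `ξ`, then the one-parameter subgroup of
`ξ` fixes `x`. -/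
theorem exists_torusExp_smul_eq_of_deriv_eq_zero {W : Type*} [NormedAddCommGroup W]
    [NormedSpace ℝ W] {f : X → W} {x : X} (hf : IsLocalDiffeomorphAt (𝓡 d) 𝓘(ℝ, W) 1 f x)
    {P : (Fin k → ℝ) →L[ℝ] W} (hP : HasFDerivAt (fun ξ : Fin k → ℝ => f (torusExp ξ • x)) P 0)
    {ξ : Fin k → ℝ} (hξ : P ξ = 0) :
    ∃ ε > 0, ∀ s : ℝ, |s| < ε → torusExp (s • ξ) • x = x := by
  obtain ⟨e, hx, he, he', hfe⟩ := hf.exists_openPartialHomeomorph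
  set c : ℝ → X := fun s => torusExp (s • ξ) • x with hc
  have hcc : Continuous c :=
    (continuous_torusExp.comp (continuous_id.smul continuous_const)).smul continuous_const
  have hc0 : c 0 = x := by simp [hc]
  have hcadd : ∀ s u, c (s + u) = torusExp (s • ξ) • c u := fun s u => by
    simp only [hc, add_smul, torusExp_add, mul_smul]
  have hev : ∀ᶠ s in 𝓝 (0 : ℝ), c s ∈ e.source :=
    hcc.continuousAt.eventually (e.open_source.mem_nhds (by rw [hc0]; exact hx))
  obtain ⟨ε, hε, hball⟩ := Metric.mem_nhds_iff.1 hev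
  have hγ0 : HasDerivAt (fun s => e (c s)) 0 0 := by
    have h1 : HasDerivAt (fun s : ℝ => s • ξ) ξ 0 := by
      simpa using (hasDerivAt_id (0 : ℝ)).smul_const ξ
    have h2 : HasDerivAt (fun s : ℝ => f (torusExp (s • ξ) • x)) (P ξ) 0 := by
      refine HasFDerivAt.comp_hasDerivAt (f := fun s : ℝ => s • ξ)
        (l := fun ξ : Fin k → ℝ => f (torusExp ξ • x)) 0 ?_ h1
      simpa using hP
    rw [hξ] at h2
    refine h2.congr_of_eventuallyEq (hev.mono fun s hs => ?_)
    exact (hfe hs).symm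
  -- The one-parameter group carries the velocity at time 0 to the velocity at time `s`, so it
  -- vanishes throughout and the curve is constant.
  have hγ : ∀ s ∈ Metric.ball (0 : ℝ) ε, HasDerivAt (fun s => e (c s)) 0 s := by
    intro s hs
    have hcs : c s ∈ e.source := hball hs
    have hΨ : ContMDiffAt 𝓘(ℝ, W) 𝓘(ℝ, W) 1
        (fun w => e (torusExp (s • ξ) • e.symm w)) (e (c 0)) := by
      have h1 : ContMDiffAt 𝓘(ℝ, W) (𝓡 d) 1 e.symm (e (c 0)) :=
        he'.contMDiffAt (e.open_target.mem_nhds (e.map_source (by rw [hc0]; exact hx)))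
      have h2 : ContMDiff (𝓡 d) (𝓡 d) 1 fun y : X => torusExp (s • ξ) • y :=
        (ContMDiffSMul.contMDiff_const_smul (I := torusModel k) (I' := 𝓡 d) (n := ∞)
          (torusExp (s • ξ))).of_le (by norm_num)
      have h3 : ContMDiffAt (𝓡 d) 𝓘(ℝ, W) 1 e (c s) :=
        he.contMDiffAt (e.open_source.mem_nhds hcs)
      have h4 : ContMDiffAt 𝓘(ℝ, W) (𝓡 d) 1 (fun w => torusExp (s • ξ) • e.symm w) (e (c 0)) :=
        h2.contMDiffAt.comp _ h1
      refine ContMDiffAt.comp (g := e) _ ?_ h4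
      rw [e.left_inv (by rw [hc0]; exact hx), ← hcadd, add_zero]
      exact h3
    have hΨd := (contMDiffAt_iff_contDiffAt.1 hΨ).differentiableAt one_ne_zero
    have h5 := hΨd.hasFDerivAt.comp_hasDerivAt (0 : ℝ) hγ0
    rw [map_zero] at h5
    have h6 : HasDerivAt (fun u => e (c (s + u))) 0 0 := by
      refine h5.congr_of_eventuallyEq (hev.mono fun u hu => ?_)
      simp only [Function.comp_apply]
      rw [e.left_inv hu, hcadd]
    have h7 : HasDerivAt (fun u => e (c (s + (u - s)))) 0 s := by
      rw [← sub_self s] at h6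
      exact h6.comp_sub_const s s
    simpa using h7
  refine ⟨ε, hε, fun s hs => ?_⟩
  have hs' : s ∈ Metric.ball (0 : ℝ) ε := by simpa using hs
  have h0' : (0 : ℝ) ∈ Metric.ball (0 : ℝ) ε := Metric.mem_ball_self hε
  have hconst := Metric.isOpen_ball.is_const_of_deriv_eq_zero
    (convex_ball (0 : ℝ) ε).isPreconnected
    (fun s hs => (hγ s hs).differentiableAt.differentiableWithinAt)
    (fun s hs => (hγ s hs).deriv) hs' h0'
  have := e.injOn (hball hs') (hball h0') hconst
  rwa [hc0] at this

variable [IsManifold (𝓡 d) ∞ X]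

/-- A character which is trivial on the stabilizer of `x` is the weight of an equivariant function
which does not vanish at `x`. -/
theorem exists_equivariant_function_eq_one [T2Space X] [CompactSpace X]
    (β : Torus k →ₜ* Circle) {x : X} (hβ : ∀ t : Torus k, t • x = x → β t = 1) :
    ∃ G : X → ℂ, ContMDiff (𝓡 d) 𝓘(ℝ, ℂ) 1 G ∧ (∀ (t : Torus k) z, G (t • z) = β t * G z) ∧
      G x = 1 := by
  let _ : MeasurableSpace (Torus k) := borel _
  have _ : BorelSpace (Torus k) := ⟨rfl⟩
  set μ : Measure (Torus k) := Measure.haarMeasure ⊤ with hμ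
  have hβc : Continuous fun t : Torus k => (β t : ℂ) :=
    Circle.isInducing_coe.continuous.comp β.continuous_toFun
  have hβic : Continuous fun t : Torus k => ((β t)⁻¹ : ℂ) :=
    hβc.inv₀ fun t => Circle.coe_ne_zero _
  have hre : ∀ t, ((β t : ℂ)⁻¹).re = (β t : ℂ).re := by
    intro t
    rw [← Circle.coe_inv, Circle.coe_inv_eq_conj, Complex.conj_re]
  -- Because `β = 1` on the stabilizer, `C • x` is compact and misses `x`. A bump function that is 1
  -- at `x` and 0 on `C • x` then makes the averaged integrand at `x` have nonnegative real part,
  -- positive at `t = 1`.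
  set C : Set (Torus k) := {t | (β t : ℂ).re ≤ 1 / 2} with hC
  have hCc : IsCompact C :=
    (isClosed_le (Complex.continuous_re.comp hβc) continuous_const).isCompact
  have hCx : IsClosed ((fun t : Torus k => t • x) '' C) :=
    (hCc.image (continuous_id.smul continuous_const)).isClosed
  have hdisj : Disjoint ((fun t : Torus k => t • x) '' C) {x} := by
    rw [Set.disjoint_singleton_right]
    rintro ⟨t, ht, htx⟩
    have h1 : (β t : ℂ).re ≤ 1 / 2 := ht
    rw [hβ t htx] at h1
    norm_num at h1
  obtain ⟨η, hη0, hη1, hη⟩ := exists_contMDiffMap_zero_one_of_isClosed (𝓡 d) (n := 1) hCx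
    isClosed_singleton hdisj
  set F : X → ℂ := fun z => (η z : ℂ) with hF
  have hFs : ContMDiff (𝓡 d) 𝓘(ℝ, ℂ) 1 F :=
    Complex.ofRealCLM.contDiff.contMDiff.comp η.contMDiff
  set G₀ : X → ℂ := fun z => ∫ t, (β t : ℂ)⁻¹ * F (t • z) ∂μ with hG₀
  have hs : ContMDiff (𝓡 d) 𝓘(ℝ, ℂ) 1 G₀ := by
    intro y
    set φ := extChartAt (𝓡 d) y with hφ
    have hO : ContMDiffOn (𝓡 d) 𝓘(ℝ, ℂ) 1 F Set.univ := hFs.contMDiffOn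
    have hdom : ∀ v ∈ φ.target, ∀ t : Torus k, (t, v) ∈ smulChartDomain k d y Set.univ :=
      fun v hv t => ⟨hv, trivial⟩
    have hcd : ContDiffOn ℝ 1 (fun v => ∫ t, (β t : ℂ)⁻¹ * F (t • φ.symm v) ∂μ) φ.target := by
      refine contDiffOn_integral_of_compactSpace (μ := μ)
        (Q' := fun v t => (β t : ℂ)⁻¹ • smulDeriv k y F (t, v))
        (isOpen_extChartAt_target y) ?_ ?_ ?_
      · intro v hv t
        exact (hasFDerivAt_smulDeriv y isOpen_univ hO (hdom v hv t)).const_mul _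
      · intro v hv
        exact hβic.mul (hFs.continuous.comp (continuous_id.smul continuous_const))
      · refine ContinuousOn.smul (hβic.comp continuous_snd).continuousOn ?_
        exact (continuousOn_smulDeriv y isOpen_univ hO).comp
          (f := fun p : EuclideanSpace ℝ (Fin d) × Torus k => (p.2, p.1)) (by fun_prop)
          fun p hp => hdom p.1 hp.1 p.2
    have h1 := (hcd.contDiffAt ((isOpen_extChartAt_target y).mem_nhds
      (mem_extChartAt_target y))).contMDiffAt.comp y
        (contMDiffAt_extChartAt (I := 𝓡 d) (n := 1) (x := y))
    refine h1.congr_of_eventuallyEq ?_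
    filter_upwards [extChartAt_source_mem_nhds (I := 𝓡 d) y] with z hz
    simp only [Function.comp_apply, hG₀]
    rw [φ.left_inv hz]
  have heq : ∀ (s : Torus k) z, G₀ (s • z) = β s * G₀ z := by
    intro s z
    have h1 : ∀ t : Torus k, (β t : ℂ)⁻¹ * F (t • s • z) =
        (β s : ℂ) * ((β (s * t) : ℂ)⁻¹ * F ((s * t) • z)) := by
      intro t
      rw [map_mul, smul_smul, mul_comm t s, Circle.coe_mul]
      field_simp [Circle.coe_ne_zero]
    simp only [hG₀, h1]
    rw [integral_const_mul, integral_mul_left_eq_self (μ := μ)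
      (fun t => (β t : ℂ)⁻¹ * F (t • z)) s]
  have hcont : Continuous fun t : Torus k => (β t : ℂ)⁻¹ * F (t • x) :=
    hβic.mul (hFs.continuous.comp (continuous_id.smul continuous_const))
  have hne : G₀ x ≠ 0 := by
    have hpos : 0 < ∫ t, ((β t : ℂ)⁻¹ * F (t • x)).re ∂μ := by
      refine (Complex.continuous_re.comp
        hcont).integral_pos_of_hasCompactSupport_nonneg_nonzero (x := 1)
        (HasCompactSupport.of_compactSpace _) (fun t => ?_) ?_
      · simp only [Pi.zero_apply, hF, Complex.re_mul_ofReal, hre]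
        by_cases ht : t ∈ C
        · rw [hη0 ⟨t, ht, rfl⟩]; simp
        · have h1 : 1 / 2 < (β t : ℂ).re := not_le.1 ht
          exact mul_nonneg (by linarith) (hη _).1
      · simp only [hF, Complex.re_mul_ofReal, one_smul, map_one]
        rw [hη1 rfl]
        simp
    intro h0
    have h1 : ∫ t, ((β t : ℂ)⁻¹ * F (t • x)).re ∂μ = (G₀ x).re :=
      Complex.reCLM.integral_comp_comm (hcont.integrable_of_hasCompactSupport
        (HasCompactSupport.of_compactSpace _))
    rw [h1, h0] at hpos
    simp at hpos
  refine ⟨fun z => (G₀ x)⁻¹ * G₀ z, ?_, fun t z => ?_, inv_mul_cancel₀ hne⟩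
  · exact (contDiff_const.mul contDiff_id).contMDiff.comp hs
  · change (G₀ x)⁻¹ * G₀ (t • z) = _
    rw [heq]
    ring

end EquivariantFunctions

/-! ### Normalizing the linear model along the orbit -/

section NormalizedModel

open Filter Topology

theorem ContinuousLinearEquiv.isLocalDiffeomorphAt_affine {E F : Type*} [NormedAddCommGroup E]
    [NormedSpace ℝ E] [NormedAddCommGroup F] [NormedSpace ℝ F] (L : E ≃L[ℝ] F) (a : E) (b : F)
    (v : E) : IsLocalDiffeomorphAt 𝓘(ℝ, E) 𝓘(ℝ, F) 1 (fun v => L (v - a) + b) v :=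
  ⟨{ toFun := fun v => L (v - a) + b
     invFun := fun w => L.symm (w - b) + a
     source := Set.univ
     target := Set.univ
     map_source' := fun _ _ => trivial
     map_target' := fun _ _ => trivial
     left_inv' := fun v _ => by simp
     right_inv' := fun w _ => by simp
     open_source := isOpen_univ
     open_target := isOpen_univ
     contMDiffOn_toFun :=
      ((L.contDiff.comp (contDiff_id.sub contDiff_const)).add
        contDiff_const).contMDiff.contMDiffOn
     contMDiffOn_invFun :=
      ((L.symm.contDiff.comp (contDiff_id.sub contDiff_const)).add
        contDiff_const).contMDiff.contMDiffOn }, trivial, fun _ _ => rfl⟩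

variable {k d n : ℕ}

theorem coe_character_torusExp (α : Torus k →ₜ* Circle) (ξ : Fin k → ℝ) :
    (α (torusExp ξ) : ℂ) = Complex.exp (charForm α ξ * Complex.I) := by
  rw [character_torusExp, Circle.coe_exp]

theorem contDiff_character_torusExp (α : Torus k →ₜ* Circle) {m : WithTop ℕ∞} :
    ContDiff ℝ m fun ξ : Fin k → ℝ => (α (torusExp ξ) : ℂ) := by
  simp only [coe_character_torusExp]
  exact ((Complex.ofRealCLM.contDiff.comp (charForm α).contDiff).mul contDiff_const).cexp

theorem hasFDerivAt_character_torusExp (α : Torus k →ₜ* Circle) :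
    HasFDerivAt (fun ξ : Fin k → ℝ => (α (torusExp ξ) : ℂ))
      (Complex.I • Complex.ofRealCLM.comp (charForm α)) 0 := by
  simp only [coe_character_torusExp]
  have h1 : HasFDerivAt (fun ξ : Fin k → ℝ => ((charForm α ξ : ℝ) : ℂ) * Complex.I)
      (Complex.I • Complex.ofRealCLM.comp (charForm α)) 0 :=
    ((Complex.ofRealCLM.comp (charForm α)).hasFDerivAt (x := 0)).mul_const Complex.I
  simpa using h1.cexp

/-- The infinitesimal action at the vector `w` of the torus on `ℂⁿ` with weights `α`. -/
noncomputable def infinitesimalAction (α : Fin n → (Torus k →ₜ* Circle)) (w : Fin n → ℂ) :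
    (Fin k → ℝ) →L[ℝ] (Fin n → ℂ) :=
  ContinuousLinearMap.pi fun i => (w i * Complex.I) • Complex.ofRealCLM.comp (charForm (α i))

theorem infinitesimalAction_apply (α : Fin n → (Torus k →ₜ* Circle)) (w : Fin n → ℂ)
    (ξ : Fin k → ℝ) (i : Fin n) :
    infinitesimalAction α w ξ i = w i * Complex.I * charForm (α i) ξ := by
  simp [infinitesimalAction]

/-- A real automorphism of some coordinates, extended by the identity. -/
noncomputable def extendLinearEquiv (I : Set (Fin n)) [DecidablePred (· ∈ I)]
    (A : ({i // i ∈ I} → ℂ) ≃ₗ[ℝ] ({i // i ∈ I} → ℂ)) : (Fin n → ℂ) ≃ₗ[ℝ] (Fin n → ℂ) where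
  toFun w i := if h : i ∈ I then A (fun j => w j) ⟨i, h⟩ else w i
  invFun w i := if h : i ∈ I then A.symm (fun j => w j) ⟨i, h⟩ else w i
  map_add' v w := by
    funext i
    by_cases h : i ∈ I
    · simp only [h, dite_true, Pi.add_apply]
      exact congrFun (map_add A (fun j : {i // i ∈ I} => v j) fun j => w j) ⟨i, h⟩
    · simp [h]
  map_smul' c w := by
    funext i
    by_cases h : i ∈ I
    · simp only [h, dite_true, Pi.smul_apply, RingHom.id_apply]
      exact congrFun (map_smul A c fun j : {i // i ∈ I} => w j) ⟨i, h⟩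
    · simp [h]
  left_inv w := by
    funext i
    by_cases h : i ∈ I <;> simp [h]
  right_inv w := by
    funext i
    by_cases h : i ∈ I <;> simp [h]

theorem extendLinearEquiv_apply_of_mem {I : Set (Fin n)} [DecidablePred (· ∈ I)]
    (A : ({i // i ∈ I} → ℂ) ≃ₗ[ℝ] ({i // i ∈ I} → ℂ)) (w : Fin n → ℂ) {i : Fin n} (h : i ∈ I) :
    extendLinearEquiv I A w i = A (fun j => w j) ⟨i, h⟩ := by
  simp [extendLinearEquiv, h]

theorem extendLinearEquiv_apply_of_notMem {I : Set (Fin n)} [DecidablePred (· ∈ I)]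
    (A : ({i // i ∈ I} → ℂ) ≃ₗ[ℝ] ({i // i ∈ I} → ℂ)) (w : Fin n → ℂ) {i : Fin n} (h : i ∉ I) :
    extendLinearEquiv I A w i = w i := by
  simp [extendLinearEquiv, h]

variable {X : Type*} [TopologicalSpace X]
  [ChartedSpace (EuclideanSpace ℝ (Fin d)) X] [MulAction (Torus k) X]
  [ContMDiffSMul (torusModel k) (𝓡 d) ∞ (Torus k) X]

theorem contDiffAt_torusExp_smul_of_contMDiffAt {W : Type*} [NormedAddCommGroup W]
    [NormedSpace ℝ W] {f : X → W} {x : X} (hf : ContMDiffAt (𝓡 d) 𝓘(ℝ, W) 1 f x) :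
    ContDiffAt ℝ 1 (fun ξ : Fin k → ℝ => f (torusExp ξ • x)) 0 := by
  rw [← contMDiffAt_iff_contDiffAt]
  have h1 : ContMDiffAt 𝓘(ℝ, Fin k → ℝ) (𝓡 d) 1 (fun ξ : Fin k → ℝ => torusExp ξ • x) 0 :=
    ((contMDiff_torusExp_smul (k := k) (d := d) (X := X)).of_le
      (by norm_num : (1 : WithTop ℕ∞) ≤ ∞)).comp (contMDiff_id.prodMk contMDiff_const) 0
  exact ContMDiffAt.comp (g := f) 0 (by simpa using hf) h1

variable [ContinuousSMul (Torus k) X]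

/-- A linear model of the action of the stabilizer can be chosen so that, to first order, it maps
the orbit of `x` to the orbit of the indicator vector of `S` compatibly with the action. -/
theorem HasLinearModel.exists_normalized {α : Fin n → (Torus k →ₜ* Circle)} {x : X}
    (h : HasLinearModel d α x) {S : Set (Fin n)}
    (hS : ∀ t : Torus k, t • x = x ↔ ∀ i ∈ S, α i t = 1) :
    ∃ f : X → (Fin n → ℂ), IsLocalDiffeomorphAt (𝓡 d) 𝓘(ℝ, Fin n → ℂ) 1 f x ∧
      (∀ᶠ z in 𝓝 x, ∀ t : Torus k, t • x = x → ∀ i, f (t • z) i = α i t * f z i) ∧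
      f x = S.indicator 1 ∧
      HasFDerivAt (fun ξ : Fin k → ℝ => f (torusExp ξ • x))
        (infinitesimalAction α (S.indicator 1)) 0 := by
  classical
  obtain ⟨f, hf, hfe⟩ := h
  set w : Fin n → ℂ := S.indicator 1 with hw
  set Q := infinitesimalAction α w with hQ
  obtain ⟨P, hP⟩ : ∃ P, HasFDerivAt (fun ξ : Fin k → ℝ => f (torusExp ξ • x)) P 0 :=
    ⟨_, ((contDiffAt_torusExp_smul_of_contMDiffAt
      hf.contMDiffAt).differentiableAt one_ne_zero).hasFDerivAt⟩
  -- On the coordinates in `I` the stabilizer acts trivially, so any real automorphism of them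
  -- preserves equivariance. All other coordinates vanish along the orbit near `x`.
  set I : Set (Fin n) := {i | ∀ t : Torus k, t • x = x → α i t = 1} with hI
  have hSI : S ⊆ I := fun i hi t ht => (hS t).1 ht i hi
  have hvanish : ∀ i ∉ I, ∀ᶠ ξ in 𝓝 (0 : Fin k → ℝ), f (torusExp ξ • x) i = 0 := by
    intro i hi
    simp only [hI, Set.mem_ofPred_eq, not_forall] at hi
    obtain ⟨t, ht, hti⟩ := hi
    have hc : Tendsto (fun ξ : Fin k → ℝ => torusExp ξ • x) (𝓝 0) (𝓝 x) := by
      have : Continuous fun ξ : Fin k → ℝ => torusExp ξ • x :=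
        continuous_torusExp.smul continuous_const
      simpa using this.tendsto 0
    filter_upwards [hc.eventually hfe] with ξ hξ
    have h1 := hξ t ht i
    rw [smul_smul, mul_comm, ← smul_smul, ht] at h1
    have h2 : ((α i t : ℂ) - 1) * f (torusExp ξ • x) i = 0 := by rw [sub_mul, ← h1]; ring
    refine (mul_eq_zero.1 h2).resolve_left fun h3 => hti ?_
    exact Circle.ext (by rw [sub_eq_zero.1 h3, Circle.coe_one])
  have hfx : ∀ i ∉ I, f x i = 0 := fun i hi => by simpa using (hvanish i hi).self_of_nhds
  have hPi : ∀ i ∉ I, ∀ ξ, P ξ i = 0 := by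
    intro i hi ξ
    have h1 : HasFDerivAt (fun ξ : Fin k → ℝ => f (torusExp ξ • x) i)
        ((ContinuousLinearMap.proj (R := ℝ) (φ := fun _ : Fin n => ℂ) i).comp P) 0 :=
      (ContinuousLinearMap.proj (R := ℝ) (φ := fun _ : Fin n => ℂ) i).hasFDerivAt.comp 0 hP
    have h2 := h1.unique ((hasFDerivAt_const (0 : ℂ) (0 : Fin k → ℝ)).congr_of_eventuallyEq
      (hvanish i hi))
    exact congrArg (fun A => A ξ) h2
  have hQi : ∀ i ∉ S, ∀ ξ, Q ξ i = 0 := by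
    intro i hi ξ
    rw [hQ, infinitesimalAction_apply, hw, Set.indicator_of_notMem hi]
    ring
  have hQS : ∀ i ∈ S, ∀ ξ, Q ξ i = 0 ↔ charForm (α i) ξ = 0 := by
    intro i hi ξ
    rw [hQ, infinitesimalAction_apply, hw, Set.indicator_of_mem hi]
    simp
  -- Both kernels are the Lie algebra of the stabilizer, so an automorphism of the `I`-coordinates
  -- takes `P` to `Q`.
  have hPQ : ∀ ξ, P ξ = 0 ↔ Q ξ = 0 := by
    intro ξ
    constructor
    · intro h0
      obtain ⟨ε, hε, hs⟩ := exists_torusExp_smul_eq_of_deriv_eq_zero hf hP h0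
      funext i
      by_cases hi : i ∈ S
      · refine (hQS i hi ξ).2 (eq_zero_of_forall_exp_eq_one hε fun s hs' => ?_)
        have h1 := (hS _).1 (hs s hs') i hi
        rw [character_torusExp, map_smul, smul_eq_mul] at h1
        exact h1
      · exact hQi i hi ξ
    · intro h0
      have hfix : ∀ s : ℝ, torusExp (s • ξ) • x = x := by
        intro s
        refine (hS _).2 fun i hi => ?_
        have h1 := (hQS i hi ξ).1 (by rw [h0]; rfl)
        rw [character_torusExp, map_smul, h1, smul_zero, Circle.exp_zero]
      have h1 : HasDerivAt (fun s : ℝ => s • ξ) ξ 0 := by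
        simpa using (hasDerivAt_id (0 : ℝ)).smul_const ξ
      have h2 : HasDerivAt (fun s : ℝ => f (torusExp (s • ξ) • x)) (P ξ) 0 := by
        refine HasFDerivAt.comp_hasDerivAt (f := fun s : ℝ => s • ξ)
          (l := fun ξ : Fin k → ℝ => f (torusExp ξ • x)) 0 ?_ h1
        simpa using hP
      simp only [hfix] at h2
      exact h2.unique (hasDerivAt_const (0 : ℝ) (f x))
  let res : (Fin n → ℂ) →ₗ[ℝ] ({i // i ∈ I} → ℂ) := LinearMap.funLeft ℝ ℂ Subtype.val
  have hres : ∀ v : Fin n → ℂ, (∀ i ∉ I, v i = 0) → (res v = 0 ↔ v = 0) := by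
    intro v hv
    refine ⟨fun h0 => funext fun i => ?_, fun h0 => by rw [h0, map_zero]⟩
    by_cases hi : i ∈ I
    · exact congrFun h0 ⟨i, hi⟩
    · exact hv i hi
  obtain ⟨A₀, hA₀⟩ := LinearMap.exists_linearEquiv_comp_eq_of_ker_eq
    (P := res ∘ₗ P.toLinearMap) (Q := res ∘ₗ Q.toLinearMap) (by
      ext ξ
      simp only [LinearMap.mem_ker, LinearMap.comp_apply, ContinuousLinearMap.coe_coe]
      rw [hres _ fun i hi => hPi i hi ξ, hres _ fun i hi => hQi i (fun h => hi (hSI h)) ξ]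
      exact hPQ ξ)
  set A := (extendLinearEquiv I A₀).toContinuousLinearEquiv with hA
  have hAapp : ∀ v, A v = extendLinearEquiv I A₀ v := fun v => rfl
  have hAPQ : ∀ ξ, A (P ξ) = Q ξ := by
    intro ξ
    funext i
    by_cases hi : i ∈ I
    · rw [hAapp, extendLinearEquiv_apply_of_mem _ _ hi]
      exact congrFun (hA₀ ξ) ⟨i, hi⟩
    · rw [hAapp, extendLinearEquiv_apply_of_notMem _ _ hi, hPi i hi,
        hQi i fun h => hi (hSI h)]
  refine ⟨fun z => A (f z - f x) + w, ?_, ?_, by simp, ?_⟩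
  · exact hf.comp _ _ (A.isLocalDiffeomorphAt_affine (f x) w (f x))
  · filter_upwards [hfe] with z hz t ht i
    simp only [Pi.add_apply, hAapp]
    by_cases hi : i ∈ I
    · rw [extendLinearEquiv_apply_of_mem _ _ hi, extendLinearEquiv_apply_of_mem _ _ hi, hi t ht,
        Circle.coe_one, one_mul]
      refine congrArg (· + w i) (congrArg (fun u => A₀ u ⟨i, hi⟩) (funext fun j => ?_))
      simp only [Pi.sub_apply]
      rw [hz t ht j, j.2 t ht, Circle.coe_one, one_mul]
    · have hwi : w i = 0 := Set.indicator_of_notMem (fun h => hi (hSI h)) _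
      rw [extendLinearEquiv_apply_of_notMem _ _ hi, extendLinearEquiv_apply_of_notMem _ _ hi, hwi,
        Pi.sub_apply, Pi.sub_apply, hz t ht i, hfx i hi]
      ring
  · have h1 : HasFDerivAt (fun ξ : Fin k → ℝ => A (f (torusExp ξ • x) - f x) + w)
        ((A : (Fin n → ℂ) →L[ℝ] (Fin n → ℂ)).comp P) 0 :=
      ((A : (Fin n → ℂ) →L[ℝ] (Fin n → ℂ)).hasFDerivAt.comp 0 (hP.sub_const (f x))).add_const w
    have h2 : (A : (Fin n → ℂ) →L[ℝ] (Fin n → ℂ)).comp P = Q := by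
      ext ξ : 1
      exact hAPQ ξ
    rwa [h2] at h1

end NormalizedModel

/-! ### Equivariant local models -/

section EquivariantModel

open Filter Topology

variable {k d n : ℕ} {X : Type*} [TopologicalSpace X]
  [ChartedSpace (EuclideanSpace ℝ (Fin d)) X]

theorem IsLocalDiffeomorphAt.exists_hasFDerivAt {W : Type*} [NormedAddCommGroup W]
    [NormedSpace ℝ W] {f : X → W} {x : X} (hf : IsLocalDiffeomorphAt (𝓡 d) 𝓘(ℝ, W) 1 f x) :
    ∃ L : EuclideanSpace ℝ (Fin d) ≃L[ℝ] W, HasFDerivAt (f ∘ (extChartAt (𝓡 d) x).symm)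
      (L : EuclideanSpace ℝ (Fin d) →L[ℝ] W) (extChartAt (𝓡 d) x x) := by
  let L : EuclideanSpace ℝ (Fin d) ≃L[ℝ] W := hf.mfderivToContinuousLinearEquiv one_ne_zero
  have h1 : HasFDerivWithinAt (f ∘ (extChartAt (𝓡 d) x).symm)
      (L : EuclideanSpace ℝ (Fin d) →L[ℝ] W) (Set.range (𝓡 d)) (extChartAt (𝓡 d) x x) :=
    (hf.mdifferentiableAt one_ne_zero).hasMFDerivAt.2
  rw [ModelWithCorners.range_eq_univ, hasFDerivWithinAt_univ] at h1
  exact ⟨L, h1⟩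

theorem Complex.contDiffAt_arg_one : ContDiffAt ℝ 1 Complex.arg 1 := by
  have h1 : ContDiffAt ℝ 1 Complex.log 1 :=
    (Complex.contDiffAt_log Complex.one_mem_slitPlane).restrict_scalars ℝ
  have h2 : ContDiffAt ℝ 1 (fun z => (Complex.log z).im) 1 :=
    Complex.imCLM.contDiff.contDiffAt.comp 1 h1
  simpa only [Complex.log_im] using h2

variable [MulAction (Torus k) X] [IsManifold (𝓡 d) ∞ X]
  [ContMDiffSMul (torusModel k) (𝓡 d) ∞ (Torus k) X] [ContinuousSMul (Torus k) X]

/-- A linear model of the action of the stabilizer of `x` extends to a model of the action of the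
whole torus. -/
theorem HasLinearModel.exists_equivariant [T2Space X] [CompactSpace X]
    {α : Fin n → (Torus k →ₜ* Circle)} {x : X}
    (h : HasLinearModel d α x) {S : Set (Fin n)}
    (hS : ∀ t : Torus k, t • x = x ↔ ∀ i ∈ S, α i t = 1) :
    ∃ g : X → (Fin n → ℂ), IsLocalDiffeomorphAt (𝓡 d) 𝓘(ℝ, Fin n → ℂ) 1 g x ∧
      (∀ᶠ z in 𝓝 x, ∀ (t : Torus k) i, g (t • z) i = α i t * g z i) ∧
      g x = S.indicator 1 := by
  obtain ⟨f, hf, hfe, hfx, hfQ⟩ := h.exists_normalized hS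
  obtain ⟨p, β, hβ, hβα⟩ := exists_linearIndependent_characters_same_kernel fun i : S => α i
  have hβx : ∀ t : Torus k, (∀ j, β j t = 1) ↔ t • x = x := fun t => by
    rw [hβα, hS]; exact Subtype.forall
  obtain ⟨B, hB⟩ := exists_section_of_linearIndependent_characters hβ
  choose G hGs hGe hGx using fun j => exists_equivariant_function_eq_one (d := d) (β j) (x := x)
    fun t ht => (hβx t).2 ht j
  -- `exp (τ z)` measures how far `z` has moved along the orbit, modulo the stabilizer of `x`. The
  -- map `g` below moves `z` back by it, applies `f`, and compensates by the weights.
  set τ : X → (Fin k → ℝ) := fun z => B fun j => (G j z).arg with hτ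
  have hτx : τ x = 0 := by
    have : (fun j => (G j x).arg) = 0 := funext fun j => by rw [hGx, Complex.arg_one]; rfl
    rw [hτ]; simp only [this, map_zero]
  set g : X → (Fin n → ℂ) := fun z i => α i (torusExp (τ z)) * f (torusExp (-τ z) • z) i with hg
  have hτs : ContMDiffAt (𝓡 d) 𝓘(ℝ, Fin k → ℝ) 1 τ x := by
    refine B.contDiff.contMDiff.contMDiffAt.comp x (contMDiffAt_pi_space.2 fun j => ?_)
    refine ContMDiffAt.comp (g := Complex.arg) (f := G j) x ?_ (hGs j).contMDiffAt
    rw [hGx]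
    exact Complex.contDiffAt_arg_one.contMDiffAt
  refine ⟨g, ?_, ?_, ?_⟩
  · set φ := extChartAt (𝓡 d) x with hφ
    set a := φ x with ha
    obtain ⟨e, hxe, he, -, hfe'⟩ := hf.exists_openPartialHomeomorph
    have hfO : ContMDiffOn (𝓡 d) 𝓘(ℝ, Fin n → ℂ) 1 f e.source := he.congr hfe'
    obtain ⟨L, hL⟩ := hf.exists_hasFDerivAt
    have hτd : ContDiffAt ℝ 1 (τ ∘ φ.symm) a := by
      rw [← contMDiffAt_iff_contDiffAt]
      refine ContMDiffAt.comp (I' := 𝓡 d) (g := τ) (f := φ.symm) a ?_ ?_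
      · have h1 : φ.symm a = x := extChartAt_to_inv (I := 𝓡 d) x
        rw [h1]; exact hτs
      · exact ((contMDiffOn_extChartAt_symm (n := ∞) x).of_le (by norm_num)).contMDiffAt
          (extChartAt_target_mem_nhds x)
    set Ψ : (Fin k → ℝ) × EuclideanSpace ℝ (Fin d) → (Fin n → ℂ) := fun q i =>
      α i (torusExp q.1) * f (torusExp (-q.1) • φ.symm q.2) i with hΨ
    have hΨs : ContDiffAt ℝ 1 Ψ (0, a) := by
      rw [contDiffAt_pi]
      intro i
      refine ContDiffAt.mul ((contDiff_character_torusExp (α i)).comp contDiff_fst).contDiffAt ?_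
      have h1 : ContDiffAt ℝ 1 (fun q : (Fin k → ℝ) × EuclideanSpace ℝ (Fin d) =>
          f (torusExp q.1 • φ.symm q.2)) (-(0 : Fin k → ℝ), a) := by
        refine (contDiffOn_torusExp_smul x hfO).contDiffAt
          (((isOpen_smulChartDomain (d := d) x e.open_source).preimage
            (continuous_torusExp.prodMap continuous_id)).mem_nhds ?_)
        refine ⟨mem_extChartAt_target x, ?_⟩
        simpa [ha, hφ] using hxe
      have h2 : ContDiffAt ℝ 1 (fun q : (Fin k → ℝ) × EuclideanSpace ℝ (Fin d) => (-q.1, q.2))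
          (0, a) := by fun_prop
      exact contDiffAt_pi.1 (ContDiffAt.comp (0, a) h1 h2) i
    obtain ⟨M, hM⟩ : ∃ M, HasFDerivAt Ψ M (0, a) :=
      ⟨_, (hΨs.differentiableAt one_ne_zero).hasFDerivAt⟩
    -- By the normalization of `f`, moving back in `X` and forward in `ℂⁿ` cancel to first order.
    -- Thus `g` has the same invertible derivative at `x` as `f`, whatever the derivative of `τ`.
    have hM1 : M.comp (ContinuousLinearMap.inl ℝ _ _) = 0 := by
      have h1 : HasFDerivAt (fun ξ => Ψ (ξ, a)) (M.comp (ContinuousLinearMap.inl ℝ _ _)) 0 :=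
        HasFDerivAt.comp (g := Ψ) (f := fun ξ : Fin k → ℝ => (ξ, a)) 0 hM
          (hasFDerivAt_prodMk_left (𝕜 := ℝ) (0 : Fin k → ℝ) a)
      refine h1.unique (hasFDerivAt_pi'.2 fun i => ?_)
      have h2 : HasFDerivAt (fun ξ : Fin k → ℝ => f (torusExp (-ξ) • x))
          ((infinitesimalAction α (S.indicator 1)).comp (-ContinuousLinearMap.id ℝ _)) 0 := by
        refine HasFDerivAt.comp (f := fun ξ : Fin k → ℝ => -ξ)
          (g := fun ξ : Fin k → ℝ => f (torusExp ξ • x)) 0 ?_ (hasFDerivAt_id (𝕜 := ℝ) _).neg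
        simpa using hfQ
      have h3 := (hasFDerivAt_character_torusExp (α i)).mul
        ((ContinuousLinearMap.proj (R := ℝ) (φ := fun _ : Fin n => ℂ) i).hasFDerivAt.comp 0 h2)
      have h4 : ∀ ξ, Ψ (ξ, a) i = (α i (torusExp ξ) : ℂ) * f (torusExp (-ξ) • x) i := fun ξ => by
        simp only [hΨ, ha, hφ, extChartAt_to_inv]
      simp only [h4]
      refine h3.congr_fderiv ?_
      ext ξ
      simp [infinitesimalAction_apply, hfx]
      ring
    have hM2 : M.comp (ContinuousLinearMap.inr ℝ _ _) = L := by
      have h1 : HasFDerivAt (fun v => Ψ (0, v)) (M.comp (ContinuousLinearMap.inr ℝ _ _)) a :=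
        hM.comp a (hasFDerivAt_prodMk_right 0 a)
      refine h1.unique (hL.congr_of_eventuallyEq (Eventually.of_forall fun v => ?_))
      funext i
      simp [hΨ, hφ]
    have hgΨ : g ∘ φ.symm = Ψ ∘ fun v => ((τ ∘ φ.symm) v, v) := rfl
    have hτa : (τ ∘ φ.symm) a = 0 := by
      simp only [Function.comp_apply, ha, hφ, extChartAt_to_inv, hτx]
    refine .of_hasFDerivAt ?_ L ?_
    · rw [hgΨ]
      refine ContDiffAt.comp a ?_ (hτd.prodMk contDiffAt_id)
      simp only [hτa]; exact hΨs
    · have h1 := (hτd.differentiableAt one_ne_zero).hasFDerivAt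
      have h2 : HasFDerivAt (Ψ ∘ fun v => ((τ ∘ φ.symm) v, v))
          (M.comp ((fderiv ℝ (τ ∘ φ.symm) a).prod (ContinuousLinearMap.id ℝ _))) a := by
        refine HasFDerivAt.comp a ?_ (h1.prodMk (hasFDerivAt_id a))
        simp only [hτa]; exact hM
      refine h2.congr_fderiv ?_
      ext v : 1
      have h3 : M (fderiv ℝ (τ ∘ φ.symm) a v, v) =
          M (fderiv ℝ (τ ∘ φ.symm) a v, 0) + M (0, v) := by
        rw [← map_add]; simp
      have h4 : M (fderiv ℝ (τ ∘ φ.symm) a v, 0) = 0 :=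
        congrArg (fun A => A (fderiv ℝ (τ ∘ φ.symm) a v)) hM1
      have h5 : M (0, v) = L v := congrArg (fun A => A v) hM2
      rw [h4, h5, zero_add] at h3
      exact h3
  · have hτc : Tendsto (fun z => torusExp (-τ z) • z) (𝓝 x) (𝓝 x) := by
      have h1 : ContinuousAt (fun z => torusExp (-τ z) • z) x :=
        (continuous_torusExp.continuousAt.comp hτs.continuousAt.neg).smul continuousAt_id
      simpa [ContinuousAt, hτx] using h1
    have hne : ∀ᶠ z in 𝓝 x, ∀ j, G j z ≠ 0 := by
      refine eventually_all.2 fun j => ?_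
      exact (hGs j).continuous.continuousAt.eventually_ne (by rw [hGx]; exact one_ne_zero)
    have hphase : ∀ j z, β j (torusExp (τ z)) = phase (G j z) := fun j z => by
      rw [character_torusExp, hτ]
      simp only [hB]
      rfl
    filter_upwards [hτc.eventually hfe, hne] with z hz hzne t i
    set s := torusExp (τ (t • z)) with hs
    set r := torusExp (τ z) with hr
    -- The discrepancy between the two corrections is killed by every `β j`, so it lies in the
    -- stabilizer, where `f` is equivariant. No smallness of `t` is needed: `arg` enters only
    -- through its exponential.
    set q := s⁻¹ * t * r with hq
    have hqx : q • x = x := by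
      refine (hβx q).1 fun j => ?_
      rw [hq, map_mul, map_mul, map_inv, hs, hr, hphase, hphase, hGe,
        phase_circle_mul _ (hzne j)]
      group
    have h1 := hz q hqx i
    have h2 : q • torusExp (-τ z) • z = torusExp (-τ (t • z)) • t • z := by
      rw [torusExp_neg, torusExp_neg, ← hs, ← hr, smul_smul, smul_smul, hq]
      congr 1
      group
    rw [h2] at h1
    simp only [hg]
    rw [h1, ← hs, ← hr]
    have h3 : α i s * α i q = α i t * α i r := by
      rw [← map_mul, ← map_mul, hq]
      congr 1
      group
    have h4 : (α i s : ℂ) * α i q = α i t * α i r := by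
      rw [← Circle.coe_mul, h3, Circle.coe_mul]
    rw [← mul_assoc, h4, mul_assoc]
  · funext i
    simp only [hg, hτx, neg_zero, torusExp_zero, one_smul, map_one, Circle.coe_one, one_mul, hfx]

/-- The action is standard around `x`: there is a linear model with weights `α` of the action
of the stabilizer, which moreover is a stabilizer of the linear action. -/
structure IsLocallyStandardAt (d : ℕ) {k n : ℕ} {X : Type*} [TopologicalSpace X]
    [ChartedSpace (EuclideanSpace ℝ (Fin d)) X] [MulAction (Torus k) X]
    (α : Fin n → (Torus k →ₜ* Circle)) (x : X) : Prop where
  hasLinearModel : HasLinearModel d α x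
  stabilizer : ∃ S : Set (Fin n), ∀ t : Torus k, t • x = x ↔ ∀ i ∈ S, α i t = 1

theorem IsLocallyStandardAt.exists_equivariant_nhds [T2Space X] [CompactSpace X]
    {α : Fin n → (Torus k →ₜ* Circle)} {x : X} (h : IsLocallyStandardAt d α x) :
    ∃ (g : X → (Fin n → ℂ)) (V : Set X), IsOpen V ∧ x ∈ V ∧
      (∀ z ∈ V, IsLocalDiffeomorphAt (𝓡 d) 𝓘(ℝ, Fin n → ℂ) 1 g z) ∧
      (∀ z ∈ V, ∀ (t : Torus k) i, g (t • z) i = α i t * g z i) ∧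
      ∀ z ∈ V, ∀ z' ∈ V, ∀ t : Torus k, (∀ i, g z' i = α i t * g z i) → z' = t • z := by
  obtain ⟨hmod, S, hS⟩ := h
  obtain ⟨g, hg, hge, hgx⟩ := hmod.exists_equivariant hS
  obtain ⟨e, hxe, -, -, hge'⟩ := hg.exists_openPartialHomeomorph
  have hgc : ContinuousAt g x := hg.contMDiffAt.continuousAt
  -- By compactness this is checked near each `t`. If `t` fixes `x`, local injectivity of `g`
  -- applies; otherwise some `i ∈ S` has `α i t ≠ 1` while `g x i = 1`, so the premise fails nearby.
  have hinj : ∀ᶠ q in 𝓝 (x, x), ∀ t ∈ (Set.univ : Set (Torus k)),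
      (∀ i, g q.2 i = α i t * g q.1 i) → q.2 = t • q.1 := by
    refine isCompact_univ.eventually_forall_of_forall_eventually fun t _ => ?_
    have hc1 : Tendsto (fun q : (X × X) × Torus k => q.1.1) (𝓝 ((x, x), t)) (𝓝 x) :=
      Continuous.tendsto' (by fun_prop) _ _ rfl
    have hc2 : Tendsto (fun q : (X × X) × Torus k => q.1.2) (𝓝 ((x, x), t)) (𝓝 x) :=
      Continuous.tendsto' (by fun_prop) _ _ rfl
    by_cases ht : t • x = x
    · have hc3 : Tendsto (fun q : (X × X) × Torus k => q.2 • q.1.1) (𝓝 ((x, x), t)) (𝓝 x) :=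
        Continuous.tendsto' (continuous_snd.smul (continuous_fst.comp continuous_fst)) _ _ ht
      have hO := e.open_source.mem_nhds hxe
      filter_upwards [hc1.eventually hge, hc2.eventually hO, hc3.eventually hO]
        with q hq1 hq2 hq3 hq
      refine e.injOn hq2 hq3 ?_
      rw [← hge' hq2, ← hge' hq3]
      funext i
      rw [hq i, hq1]
    · obtain ⟨i, hi, hit⟩ : ∃ i ∈ S, α i t ≠ 1 := by
        by_contra hcon
        push Not at hcon
        exact ht ((hS t).2 hcon)
      have hα : Continuous fun s : Torus k => (α i s : ℂ) :=
        Circle.isInducing_coe.continuous.comp (α i).continuous_toFun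
      have h1 : Tendsto (fun q : (X × X) × Torus k => g q.1.2 i - α i q.2 * g q.1.1 i)
          (𝓝 ((x, x), t)) (𝓝 (g x i - α i t * g x i)) := by
        have hgi : Tendsto (fun z => g z i) (𝓝 x) (𝓝 (g x i)) := (tendsto_pi_nhds.1 hgc) i
        refine (hgi.comp hc2).sub (Tendsto.mul ?_ (hgi.comp hc1))
        exact (hα.comp continuous_snd).tendsto ((x, x), t)
      have h2 : g x i - α i t * g x i ≠ 0 := by
        rw [hgx, Set.indicator_of_mem hi]
        simp only [Pi.one_apply, mul_one]
        intro h0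
        exact hit (Circle.ext (by rw [← sub_eq_zero.1 h0, Circle.coe_one]))
      filter_upwards [h1.eventually_ne h2] with q hq hq'
      exact absurd (sub_eq_zero.2 (hq' i)) hq
  rw [nhds_prod_eq] at hinj
  obtain ⟨U, hU, hUinj⟩ := (eventually_prod_self_iff (r := fun z z' =>
    ∀ t ∈ (Set.univ : Set (Torus k)), (∀ i, g z' i = α i t * g z i) → z' = t • z)).1 hinj
  obtain ⟨V, hV, hVo, hxV⟩ := mem_nhds_iff.1 (inter_mem hU (hg.eventually.and hge))
  exact ⟨g, V, hVo, hxV, fun z hz => (hV hz).2.1, fun z hz => (hV hz).2.2,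
    fun z hz z' hz' t ht => hUinj z (hV hz).1 z' (hV hz').1 t trivial ht⟩

/-- The same equivariant `g` serves as model at every nearby `y`; the stabilizer of `y` is cut out
by the weights of the nonzero coordinates of `g y`. -/
theorem IsLocallyStandardAt.eventually [T2Space X] [CompactSpace X]
    {α : Fin n → (Torus k →ₜ* Circle)} {x : X} (h : IsLocallyStandardAt d α x) :
    ∀ᶠ y in 𝓝 x, IsLocallyStandardAt d α y := by
  obtain ⟨g, V, hV, hxV, hloc, hequiv, hinj⟩ := h.exists_equivariant_nhds
  filter_upwards [hV.mem_nhds hxV] with y hy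
  refine ⟨⟨g, hloc y hy, ?_⟩, {i | g y i ≠ 0}, fun t => ⟨fun ht i hi => ?_, fun ht => ?_⟩⟩
  · filter_upwards [hV.mem_nhds hy] with z hz t _ i using hequiv z hz t i
  · have h1 := hequiv y hy t i
    rw [ht] at h1
    have h2 : (1 : ℂ) * g y i = α i t * g y i := by rw [one_mul]; exact h1
    exact Circle.ext (by rw [← mul_right_cancel₀ hi h2, Circle.coe_one])
  · refine (hinj y hy y hy t fun i => ?_).symm
    by_cases hi : g y i = 0
    · rw [hi, mul_zero]
    · rw [ht i hi, Circle.coe_one, one_mul]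

end EquivariantModel

/-! ### Charts of the orbit space -/

section OrbitSpace

open Filter Topology

theorem continuousOn_comp_invFunOn {X B C : Type*} [TopologicalSpace X] [TopologicalSpace B]
    [TopologicalSpace C] [Nonempty X] {p : X → B} {q : X → C} {V : Set X} (hV : IsOpen V)
    (hpo : ∀ U ⊆ V, IsOpen U → IsOpen (p '' U)) (hq : ContinuousOn q V)
    (hpq : ∀ z ∈ V, ∀ z' ∈ V, p z = p z' → q z = q z') :
    ContinuousOn (q ∘ Function.invFunOn p V) (p '' V) := by
  refine (continuousOn_open_iff (hpo V subset_rfl hV)).2 fun O hO => ?_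
  have h : p '' V ∩ (q ∘ Function.invFunOn p V) ⁻¹' O = p '' (V ∩ q ⁻¹' O) := by
    ext b
    constructor
    · rintro ⟨hb, hbO⟩
      exact ⟨_, ⟨Function.invFunOn_mem hb, hbO⟩, Function.invFunOn_eq hb⟩
    · rintro ⟨z, ⟨hz, hzO⟩, rfl⟩
      have hb : p z ∈ p '' V := ⟨z, hz, rfl⟩
      refine ⟨hb, ?_⟩
      have h1 : q (Function.invFunOn p V (p z)) = q z :=
        hpq _ (Function.invFunOn_mem hb) z hz (Function.invFunOn_eq hb)
      change q (Function.invFunOn p V (p z)) ∈ O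
      rw [h1]
      exact hzO
  rw [h]
  exact hpo _ Set.inter_subset_left (hq.isOpen_inter_preimage hV hO)

/-- Two continuous open maps with the same fibres have homeomorphic images. -/
theorem exists_openPartialHomeomorph_of_fibres_eq {X B C : Type*} [TopologicalSpace X]
    [TopologicalSpace B] [TopologicalSpace C] {p : X → B} {q : X → C} {V : Set X} {x : X}
    (hV : IsOpen V) (hx : x ∈ V) (hp : ContinuousOn p V) (hq : ContinuousOn q V)
    (hpo : ∀ U ⊆ V, IsOpen U → IsOpen (p '' U)) (hqo : ∀ U ⊆ V, IsOpen U → IsOpen (q '' U))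
    (hpq : ∀ z ∈ V, ∀ z' ∈ V, p z = p z' ↔ q z = q z') :
    ∃ e : OpenPartialHomeomorph B C, p x ∈ e.source := by
  have : Nonempty X := ⟨x⟩
  have hleft : ∀ z ∈ V, q (Function.invFunOn p V (p z)) = q z := fun z hz =>
    have hb : p z ∈ p '' V := ⟨z, hz, rfl⟩
    (hpq _ (Function.invFunOn_mem hb) z hz).1 (Function.invFunOn_eq hb)
  have hright : ∀ z ∈ V, p (Function.invFunOn q V (q z)) = p z := fun z hz =>
    have hb : q z ∈ q '' V := ⟨z, hz, rfl⟩
    (hpq _ (Function.invFunOn_mem hb) z hz).2 (Function.invFunOn_eq hb)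
  refine ⟨{ toFun := q ∘ Function.invFunOn p V
            invFun := p ∘ Function.invFunOn q V
            source := p '' V
            target := q '' V
            map_source' := ?_
            map_target' := ?_
            left_inv' := ?_
            right_inv' := ?_
            open_source := hpo V subset_rfl hV
            open_target := hqo V subset_rfl hV
            continuousOn_toFun := continuousOn_comp_invFunOn hV hpo hq
              fun z hz z' hz' => (hpq z hz z' hz').1
            continuousOn_invFun := continuousOn_comp_invFunOn hV hqo hp
              fun z hz z' hz' => (hpq z hz z' hz').2 }, ⟨x, hx, rfl⟩⟩
  · rintro _ ⟨z, hz, rfl⟩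
    exact ⟨z, hz, (hleft z hz).symm⟩
  · rintro _ ⟨z, hz, rfl⟩
    exact ⟨z, hz, (hright z hz).symm⟩
  · rintro _ ⟨z, hz, rfl⟩
    simp only [Function.comp_apply, hleft z hz, hright z hz]
  · rintro _ ⟨z, hz, rfl⟩
    simp only [Function.comp_apply, hleft z hz, hright z hz]

theorem nonempty_chartedSpace_of_forall_exists {H M : Type*} [TopologicalSpace H]
    [TopologicalSpace M] (h : ∀ x : M, ∃ e : OpenPartialHomeomorph M H, x ∈ e.source) :
    Nonempty (ChartedSpace H M) := by
  choose e he using h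
  exact ⟨{ atlas := Set.range e
           chartAt := e
           mem_chart_source := he
           chart_mem_atlas := Set.mem_range_self }⟩

/-- The orbit relation is the image of the compact space `G × X`, hence closed, and the quotient map
is open. -/
theorem t2Space_orbitRel_quotient {G X : Type*} [Group G] [TopologicalSpace G] [CompactSpace G]
    [TopologicalSpace X] [T2Space X] [CompactSpace X] [MulAction G X] [ContinuousSMul G X] :
    T2Space (MulAction.orbitRel.Quotient G X) := by
  refine (t2Space_iff_of_isOpenQuotientMap MulAction.isOpenQuotientMap_quotientMk).2 ?_
  have h1 : IsCompact (Set.range fun q : G × X => (q.1 • q.2, q.2)) :=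
    isCompact_range (continuous_smul.prodMk continuous_snd)
  convert h1.isClosed using 1
  ext ⟨y, z⟩
  constructor
  · intro h
    obtain ⟨t, ht⟩ := MulAction.orbitRel_apply.1 (Quotient.exact h)
    exact ⟨(t, z), Prod.ext ht rfl⟩
  · rintro ⟨⟨t, w⟩, h⟩
    obtain ⟨rfl, rfl⟩ := Prod.ext_iff.1 h
    exact Quotient.sound (MulAction.orbitRel_apply.2 ⟨t, rfl⟩)

theorem subgroupDim_le {k : ℕ} (H : Subgroup (Torus k)) : subgroupDim H ≤ k := by
  simpa [subgroupDim] using Submodule.finrank_le (torusLieAlgebra H)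

variable {k d n : ℕ} {X : Type*} [TopologicalSpace X]
  [ChartedSpace (EuclideanSpace ℝ (Fin d)) X] [MulAction (Torus k) X] [IsManifold (𝓡 d) ∞ X]
  [ContMDiffSMul (torusModel k) (𝓡 d) ∞ (Torus k) X] [ContinuousSMul (Torus k) X] [T2Space X]
  [CompactSpace X]

/-- Openness at `x'` reaches some point of the component, along which being standard is open and
closed. -/
theorem IsLocallyStandardAt.of_mem_closure_connectedComponentIn
    {α : Fin n → (Torus k →ₜ* Circle)} {x x' : X}
    (hx' : x' ∈ closure (connectedComponentIn
      (orbitTypePiece X (MulAction.stabilizer (Torus k) x)) x))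
    (h : IsLocallyStandardAt d α x') : IsLocallyStandardAt d α x := by
  set P := orbitTypePiece X (MulAction.stabilizer (Torus k) x) with hP
  set C := connectedComponentIn P x with hC
  have hxC : x ∈ C := mem_connectedComponentIn (F := P) rfl
  have hst : ∀ z ∈ C, ∀ t : Torus k, t • z = z ↔ t • x = x := fun z hz t => by
    have h1 : MulAction.stabilizer (Torus k) z = MulAction.stabilizer (Torus k) x :=
      connectedComponentIn_subset P x hz
    rw [← MulAction.mem_stabilizer_iff, h1, MulAction.mem_stabilizer_iff]
  obtain ⟨y, hy, hyC⟩ := mem_closure_iff_nhds.1 hx' _ h.eventually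
  refine (isPreconnected_connectedComponentIn.induction₂
    (fun y z => IsLocallyStandardAt d α y ↔ IsLocallyStandardAt d α z) (fun y hyC => ?_)
    (fun _ _ _ _ _ _ h1 h2 => h1.trans h2) (fun _ _ _ _ h1 => h1.symm) hyC hxC).1 hy
  have h1 : ∀ᶠ z in 𝓝 y, IsLocallyStandardAt d α y → IsLocallyStandardAt d α z := by
    by_cases h : IsLocallyStandardAt d α y
    · exact h.eventually.mono fun _ hz _ => hz
    · exact Eventually.of_forall fun _ h' => absurd h' h
  have h2 := eventually_hasLinearModel_of_stabilizer_eq (d := d) (k := k) (α := α) y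
  filter_upwards [nhdsWithin_le_nhds h1, nhdsWithin_le_nhds h2, self_mem_nhdsWithin]
    with z hz1 hz2 hzC
  refine ⟨hz1, fun hz => ⟨hz2 ?_ hz.hasLinearModel, ?_⟩⟩
  · exact (connectedComponentIn_subset P x hzC).trans (connectedComponentIn_subset P x hyC).symm
  · obtain ⟨S, hS⟩ := hz.stabilizer
    exact ⟨S, fun t => by rw [hst y hyC, ← hst z hzC, hS]⟩

/-- On the neighbourhood `V` the orbit projection and `Q ∘ g` are open and continuous with the same
fibres, so their images are homeomorphic. -/
theorem IsLocallyStandardAt.exists_chart (hn : 1 ≤ n) {X : Type*} [TopologicalSpace X]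
    [ChartedSpace (EuclideanSpace ℝ (Fin d)) X] [MulAction (Torus (n - 1)) X]
    [IsManifold (𝓡 d) ∞ X] [ContMDiffSMul (torusModel (n - 1)) (𝓡 d) ∞ (Torus (n - 1)) X]
    [ContinuousSMul (Torus (n - 1)) X] [T2Space X] [CompactSpace X]
    {α : Fin n → (Torus (n - 1) →ₜ* Circle)} (hα : WeightsInGeneralPosition α) {x : X}
    (h : IsLocallyStandardAt d α x) :
    ∃ e : OpenPartialHomeomorph (MulAction.orbitRel.Quotient (Torus (n - 1)) X)
      (EuclideanSpace ℝ (Fin (n + 1))), (Quotient.mk _ x) ∈ e.source := by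
  obtain ⟨g, V, hV, hxV, hloc, hequiv, hinj⟩ := h.exists_equivariant_nhds
  obtain ⟨Q, hQc, hQo, hQ⟩ := exists_open_orbit_map hn hα
  have hp : IsOpenQuotientMap (Quotient.mk (MulAction.orbitRel (Torus (n - 1)) X)) :=
    MulAction.isOpenQuotientMap_quotientMk
  have hgc : ContinuousOn g V := fun z hz =>
    (hloc z hz).contMDiffAt.continuousAt.continuousWithinAt
  refine exists_openPartialHomeomorph_of_fibres_eq (q := Q ∘ g) hV hxV hp.continuous.continuousOn
    (hQc.comp_continuousOn hgc) (fun U _ hU => hp.isOpenMap U hU) (fun U hUV hU => ?_)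
    fun z hz z' hz' => ?_
  · rw [Set.image_comp]
    refine hQo _ (isOpen_iff_mem_nhds.2 ?_)
    rintro _ ⟨z, hz, rfl⟩
    obtain ⟨e, hze, -, -, he⟩ := (hloc z (hUV hz)).exists_openPartialHomeomorph
    have h1 : map g (𝓝 z) = 𝓝 (g z) := by
      rw [he hze, ← e.map_nhds_eq hze]
      exact map_congr (he.eventuallyEq_of_mem (e.open_source.mem_nhds hze))
    rw [← h1]
    exact image_mem_map (hU.mem_nhds hz)
  · rw [Function.comp_apply, Function.comp_apply, hQ]
    constructor
    · intro h
      obtain ⟨t, ht⟩ := MulAction.orbitRel_apply.1 (Quotient.exact h)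
      refine ⟨t, fun i => ?_⟩
      rw [← hequiv z' hz' t i]
      exact congrArg (fun w => g w i) ht.symm
    · rintro ⟨t, ht⟩
      exact Quotient.sound (MulAction.orbitRel_apply.2 ⟨t, (hinj z' hz' z hz t ht).symm⟩)

end OrbitSpace

/-! ### Induction on the codimension of the stabilizer, and the theorem -/

theorem exists_isLocallyStandardAt {k n : ℕ} {X : Type*} [TopologicalSpace X] [T2Space X]
    [CompactSpace X] [ChartedSpace (EuclideanSpace ℝ (Fin (2 * n))) X]
    [IsManifold (𝓡 (2 * n)) ∞ X] [MulAction (Torus k) X]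
    [ContMDiffSMul (torusModel k) (𝓡 (2 * n)) ∞ (Torus k) X] [ContinuousSMul (Torus k) X]
    (happ : IsAppropriate k X) (hgen : ActionInGeneralPosition k n X) (x : X) :
    ∃ α : Fin n → (Torus k →ₜ* Circle),
      WeightsInGeneralPosition α ∧ IsLocallyStandardAt (2 * n) α x := by
  induction hm : k - subgroupDim (MulAction.stabilizer (Torus k) x) using Nat.strong_induction_on
    generalizing x with
  | _ m ih =>
    by_cases hx : MulAction.stabilizer (Torus k) x = ⊤
    · have hxf : x ∈ MulAction.fixedPoints (Torus k) X := fun t =>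
        MulAction.mem_stabilizer_iff.1 (hx ▸ Subgroup.mem_top t)
      obtain ⟨α, hw, hα⟩ := hgen x hxf
      -- The empty set of weights cuts out the whole torus.
      exact ⟨α, hα, hasLinearModel_of_hasWeights hxf hw, ∅, fun t => by simp [hxf t]⟩
    · obtain ⟨x', hx', hlt⟩ := happ.adjoining _ (isClosed_stabilizer x) hx x rfl
      have hle := subgroupDim_le (MulAction.stabilizer (Torus k) x')
      obtain ⟨α, hα, h⟩ := ih _ (by omega) x' rfl
      exact ⟨α, hα, h.of_mem_closure_connectedComponentIn hx'⟩

theorem theorem1 (n : ℕ) (hn : 1 ≤ n)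
    (X : Type*) [TopologicalSpace X] [T2Space X] [CompactSpace X]
    [ChartedSpace (EuclideanSpace ℝ (Fin (2 * n))) X] [IsManifold (𝓡 (2 * n)) ∞ X]
    [MulAction (Torus (n - 1)) X]
    [ContMDiffSMul (torusModel (n - 1)) (𝓡 (2 * n)) ∞ (Torus (n - 1)) X]
    (happ : IsAppropriate (n - 1) X)
    (hgen : ActionInGeneralPosition (n - 1) n X) :
    IsTopologicalManifold (n + 1) (MulAction.orbitRel.Quotient (Torus (n - 1)) X) := by
  have : ContinuousSMul (Torus (n - 1)) X :=
    ContMDiffSMul.continuousSMul (I := torusModel (n - 1)) (I' := 𝓡 (2 * n)) ∞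
  have hchart : Nonempty (ChartedSpace (EuclideanSpace ℝ (Fin (n + 1)))
      (MulAction.orbitRel.Quotient (Torus (n - 1)) X)) := by
    refine nonempty_chartedSpace_of_forall_exists fun y => ?_
    obtain ⟨x, rfl⟩ := Quotient.exists_rep y
    obtain ⟨α, hα, h⟩ := exists_isLocallyStandardAt happ hgen x
    exact h.exists_chart hn hα
  refine ⟨t2Space_orbitRel_quotient, ?_, hchart⟩
  obtain ⟨_⟩ := hchart
  have : CompactSpace (MulAction.orbitRel.Quotient (Torus (n - 1)) X) := Quotient.compactSpace
  exact ChartedSpace.secondCountable_of_sigmaCompact (EuclideanSpace ℝ (Fin (n + 1))) _
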